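/- All posets are finite. An element $a$ of a lattice is *meet-reducible* (*join-reducible*) if $a=b\wedge c$ ($a=b\vee c$) for some $b,c\ne a$, and *reducible* if it is one or the other. A *block* is a finite lattice in which $0$ is meet-reducible and $1$ is join-reducible. The *nullity* of a poset is $|E|-|V|+c$ for its cover graph with $|E|$ edges, $|V|$ vertices and $c$ connected components. In a poset, an element is *doubly irreducible* if it has at most one upper cover and at most one lower cover, and *reducible* otherwise (for finite lattices this agrees with the above). A doubly irreducible element $x$ of a poset is *retractible* if either there are no reducible $y,z$ with $y\prec x\prec z$, or there are such $y,z$ and $y\prec x\prec z$ is the only directed path of coverings from $y$ to $z$. The *basic block associated to* a poset $P$ is obtained from $P$ by successively removing retractible elements that have exactly one upper and exactly one lower cover, until there are none, and then successively removing the pendant vertices (vertices of degree one in the cover graph), until there are none. For lattices $L_1,L_2$ and $a<b$ in $L_1$ with $b$ not covering $a$, the *adjunct* $L_1]_a^bL_2$ is the disjoint union of $L_1$ and $L_2$ with the given orders and, for $x\in L_1$, $y\in L_2$: $x\le y$ iff $x\le a$, and $y\le x$ iff $b\le x$. Let $B_1=C]_a^1\{c_1\}]_0^b\{c_2\}]_0^b\{c_3\}$,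 where $C$ is the chain $0\prec a\prec b\prec 1$ (a lattice with $7$ elements), and let $B_2=B_1^*$ be its dual. For $i=1,2$ let $\mathbb B_i(j;4,3)$ be the class of all blocks with $j$ elements, considered up to isomorphism, that have exactly four reducible elements, these being pairwise comparable, have nullity $3$, and whose associated basic block is $B_i$. Let $P_l^2$ be the number of partitions of $l$ into two positive parts. **Proposition.** For every $j\ge 7$, $$|\mathbb B_1(j;4,3)|=|\mathbb B_2(j;4,3)|=\sum_{s=1}^{j-6}\ \sum_{r=1}^{j-s-5}\ \sum_{l=2}^{j-s-r-3}(j-s-r-l-2)\,P_l^2 .$$ Moreover, every $\mathbf B\in\mathbb B_1(j;4,3)$, with reducible elements $0<a<b<1$, has an adjunct representation $\mathbf B=C_0]_a^1C_1]_0^bC_2]_0^bC_3$, where $C_0$ is a maximal chain of $\mathbf B$ containing all its reducible elements and $C_1,C_2,C_3$ are nonempty chains. -/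

import Mathlib

/-! ### Reducible elements, cover graph, nullity, blocks -/

/-- `a` is meet-reducible: `inf {b, c} = a` for some `b, c` both distinct from `a`. -/
def IsMeetReducible {L : Type*} [Lattice L] (a : L) : Prop :=
  ∃ b c : L, b ≠ a ∧ c ≠ a ∧ b ⊓ c = a

/-- `a` is join-reducible: `sup {b, c} = a` for some `b, c` both distinct from `a`. -/
def IsJoinReducible {L : Type*} [Lattice L] (a : L) : Prop :=
  ∃ b c : L, b ≠ a ∧ c ≠ a ∧ b ⊔ c = a

/-- The set of reducible elements of a lattice. -/
def redSet (L : Type*) [Lattice L] : Set L :=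
  {a | IsMeetReducible a ∨ IsJoinReducible a}

/-- The nullity `|E| - |V| + c` of the cover graph of a finite poset. -/
noncomputable def nullity (P : Type*) [PartialOrder P] : ℤ :=
  (Nat.card (SimpleGraph.hasse P).edgeSet : ℤ) - (Nat.card P : ℤ)
    + (Nat.card (SimpleGraph.hasse P).ConnectedComponent : ℤ)

/-- A block: a (finite) lattice whose least element is meet-reducible and whose largest element is
join-reducible. -/
def IsBlock (L : Type*) [Lattice L] : Prop :=
  (∃ x : L, IsBot x ∧ IsMeetReducible x) ∧ (∃ x : L, IsTop x ∧ IsJoinReducible x)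

/-! ### Retractible elements, basic retracts, associated basic blocks -/

/-- At most one upper cover and at most one lower cover. -/
def IsDoublyIrreducible {P : Type*} [PartialOrder P] (x : P) : Prop :=
  {y | x ⋖ y}.Subsingleton ∧ {y | y ⋖ x}.Subsingleton

/-- In a finite lattice the reducible elements are those that are not doubly irreducible, so that
the notions of reducibility for lattices and for posets agree. -/
theorem mem_redSet_iff {L : Type*} [Lattice L] [Finite L] (a : L) :
    a ∈ redSet L ↔ ¬ IsDoublyIrreducible a := by
  constructor
  · rintro (⟨b, c, hb, hc, h⟩ | ⟨b, c, hb, hc, h⟩) ⟨h1, h2⟩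
    · have hab : a < b := lt_of_le_of_ne (h ▸ inf_le_left) hb.symm
      have hac : a < c := lt_of_le_of_ne (h ▸ inf_le_right) hc.symm
      obtain ⟨x, hx, hxb⟩ := exists_covBy_le_of_lt hab
      obtain ⟨y, hy, hyc⟩ := exists_covBy_le_of_lt hac
      obtain rfl : x = y := h1 hx hy
      exact absurd (h ▸ le_inf hxb hyc) hx.lt.not_ge
    · have hab : b < a := lt_of_le_of_ne (h ▸ le_sup_left) hb
      have hac : c < a := lt_of_le_of_ne (h ▸ le_sup_right) hc
      obtain ⟨x, hxb, hx⟩ := exists_le_covBy_of_lt hab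
      obtain ⟨y, hyc, hy⟩ := exists_le_covBy_of_lt hac
      obtain rfl : x = y := h2 hx hy
      exact absurd (h ▸ sup_le hxb hyc) hx.lt.not_ge
  · intro h
    by_cases h1 : {y | a ⋖ y}.Subsingleton
    · have h2 : ¬ {y | y ⋖ a}.Subsingleton := fun h2 => h ⟨h1, h2⟩
      rw [Set.not_subsingleton_iff] at h2
      obtain ⟨x, hx, y, hy, hxy⟩ := h2
      have h3 : x ⊔ y ≤ a := sup_le hx.le hy.le
      refine Or.inr ⟨x, y, hx.ne, hy.ne, (hx.eq_or_eq le_sup_left h3).resolve_left fun h4 => ?_⟩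
      exact (hy.eq_or_eq (sup_eq_left.mp h4) hx.le).elim hxy hx.ne
    · rw [Set.not_subsingleton_iff] at h1
      obtain ⟨x, hx, y, hy, hxy⟩ := h1
      have h3 : a ≤ x ⊓ y := le_inf hx.le hy.le
      refine Or.inl ⟨x, y, hx.ne', hy.ne', (hx.eq_or_eq h3 inf_le_left).resolve_right fun h4 => ?_⟩
      exact (hy.eq_or_eq hx.le (inf_eq_left.mp h4)).elim hx.ne' hxy

/-- Exactly one upper cover and exactly one lower cover. -/
def IsIrrStar {P : Type*} [PartialOrder P] (x : P) : Prop :=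
  (∃! y, x ⋖ y) ∧ (∃! y, y ⋖ x)

/-- `l` lists the vertices of a directed (upward) path from `y` to `z` in the cover graph. -/
def IsDirectedPath {P : Type*} [PartialOrder P] (l : List P) (y z : P) : Prop :=
  l.IsChain (· ⋖ ·) ∧ l.head? = some y ∧ l.getLast? = some z

/-- A doubly irreducible `x` is retractible if there are no reducible `y, z` with `y ⋖ x ⋖ z`, or
there are such `y, z` with no directed path from `y` to `z` other than `y, x, z`. -/
def IsRetractible {P : Type*} [PartialOrder P] (x : P) : Prop :=
  IsDoublyIrreducible x ∧
    ((¬ ∃ y z : P, ¬ IsDoublyIrreducible y ∧ ¬ IsDoublyIrreducible z ∧ y ⋖ x ∧ x ⋖ z) ∨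
      ∃ y z : P, ¬ IsDoublyIrreducible y ∧ ¬ IsDoublyIrreducible z ∧ y ⋖ x ∧ x ⋖ z ∧
        ∀ l : List P, IsDirectedPath l y z → l = [y, x, z])

/-- A basic retract: no element with exactly one upper and one lower cover is retractible. -/
def IsBasicRetract (P : Type*) [PartialOrder P] : Prop :=
  ∀ x : P, IsIrrStar x → ¬ IsRetractible x

/-- A pendant vertex of the cover graph: a vertex of degree one. -/
def IsPendant {P : Type*} [PartialOrder P] (x : P) : Prop :=
  ∃! y, (SimpleGraph.hasse P).Adj x y

/-- `T` arises from the subposet `S` by removing one retractible element of `Irr*(S)`. -/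
def RetractStep {P : Type*} [PartialOrder P] (S T : Set P) : Prop :=
  ∃ x : S, IsIrrStar x ∧ IsRetractible x ∧ T = S \ {(x : P)}

/-- `T` arises from the subposet `S` by removing one pendant vertex. -/
def PendantStep {P : Type*} [PartialOrder P] (S T : Set P) : Prop :=
  ∃ x : S, IsPendant x ∧ T = S \ {(x : P)}

/-- `B` is (up to isomorphism) the basic block associated to `P`: retractible elements of `P` are
removed successively until a basic retract `S` is reached, and then pendant vertices are removed
successively until none is left. -/
def IsAssociatedBasicBlock (B P : Type*) [PartialOrder B] [PartialOrder P] : Prop :=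
  ∃ S T : Set P, Relation.ReflTransGen RetractStep Set.univ S ∧ IsBasicRetract S ∧
    Relation.ReflTransGen PendantStep S T ∧ (∀ x : T, ¬ IsPendant x) ∧ Nonempty (B ≃o T)

/-! ### Adjunct sums -/

/-- `(a, b)` may serve as an adjunct pair: `a < b`, and `b` does not cover `a`. -/
structure IsAdjunctPair {L : Type*} [PartialOrder L] (a b : L) : Prop where
  lt : a < b
  not_covBy : ¬ a ⋖ b

/-- The adjunct sum `L₁ ]_a^b L₂`, on the disjoint union of `L₁` and `L₂`. -/
inductive Adjunct (L₁ L₂ : Type) [PartialOrder L₁] {a b : L₁} (h : IsAdjunctPair a b) : Type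
  | inl : L₁ → Adjunct L₁ L₂ h
  | inr : L₂ → Adjunct L₁ L₂ h

namespace Adjunct

variable {L₁ L₂ : Type} [PartialOrder L₁] [PartialOrder L₂] {a b : L₁} {h : IsAdjunctPair a b}

/-- The order of the adjunct sum. -/
protected def le : Adjunct L₁ L₂ h → Adjunct L₁ L₂ h → Prop
  | .inl x, .inl y => x ≤ y
  | .inr x, .inr y => x ≤ y
  | .inl x, .inr _ => x ≤ a
  | .inr _, .inl y => b ≤ y

instance : PartialOrder (Adjunct L₁ L₂ h) where
  le := Adjunct.le
  le_refl x := by cases x <;> exact le_refl _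
  le_trans x y z hxy hyz := by
    have hab := h.lt
    rcases x with x | x <;> rcases y with y | y <;> rcases z with z | z <;>
      simp only [Adjunct.le] at hxy hyz ⊢
    · exact hxy.trans hyz
    · exact hxy.trans hyz
    · exact hxy.trans (hab.le.trans hyz)
    · exact hxy
    · exact hxy.trans hyz
    · exact absurd (hab.trans_le (hxy.trans hyz)) (lt_irrefl _)
    · exact hyz
    · exact hxy.trans hyz
  le_antisymm x y hxy hyx := by
    have hab := h.lt
    rcases x with x | x <;> rcases y with y | y <;> simp only [Adjunct.le] at hxy hyx
    · exact congrArg inl (le_antisymm hxy hyx)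
    · exact absurd (hab.trans_le (hyx.trans hxy)) (lt_irrefl _)
    · exact absurd (hab.trans_le (hxy.trans hyx)) (lt_irrefl _)
    · exact congrArg inr (le_antisymm hxy hyx)

theorem inl_lt_inl {x y : L₁} (hxy : x < y) : (inl x : Adjunct L₁ L₂ h) < inl y :=
  lt_of_le_not_ge (show x ≤ y from hxy.le) (fun hc => hxy.not_ge (show y ≤ x from hc))

theorem isAdjunctPair_inl {x y z : L₁} (hxy : x < y) (hyz : y < z) :
    IsAdjunctPair (inl x : Adjunct L₁ L₂ h) (inl z) :=
  ⟨inl_lt_inl (hxy.trans hyz), fun hc => hc.2 (inl_lt_inl hxy) (inl_lt_inl hyz)⟩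

end Adjunct

/-! ### The basic blocks `B₁` and `B₂` -/

theorem isAdjunctPair_fin_four : IsAdjunctPair (1 : Fin 4) 3 :=
  ⟨by decide, fun hc => hc.2 (c := 2) (by decide) (by decide)⟩

/-- `C ]_a^1 {c₁}`, where `C` is the `4`-chain `0 ⋖ a ⋖ b ⋖ 1`, encoded as `0, 1, 2, 3 : Fin 4`. -/
abbrev BasicBlockOneStepA : Type := Adjunct (Fin 4) (Fin 1) isAdjunctPair_fin_four

theorem isAdjunctPair_stepA :
    IsAdjunctPair (Adjunct.inl 0 : BasicBlockOneStepA) (Adjunct.inl 2) :=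
  Adjunct.isAdjunctPair_inl (y := 1) (by decide) (by decide)

/-- `C ]_a^1 {c₁} ]_0^b {c₂}`. -/
abbrev BasicBlockOneStepB : Type := Adjunct BasicBlockOneStepA (Fin 1) isAdjunctPair_stepA

theorem isAdjunctPair_stepB :
    IsAdjunctPair (Adjunct.inl (Adjunct.inl 0) : BasicBlockOneStepB)
      (Adjunct.inl (Adjunct.inl 2)) :=
  Adjunct.isAdjunctPair_inl (y := Adjunct.inl 1) (Adjunct.inl_lt_inl (by decide))
    (Adjunct.inl_lt_inl (by decide))

/-- `B₁ = C ]_a^1 {c₁} ]_0^b {c₂} ]_0^b {c₃}`: the seven-element lattice with the nine coverings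
`0 ⋖ a ⋖ b ⋖ 1`, `a ⋖ c₁ ⋖ 1`, `0 ⋖ c₂ ⋖ b`, `0 ⋖ c₃ ⋖ b`. -/
abbrev BasicBlockOne : Type := Adjunct BasicBlockOneStepB (Fin 1) isAdjunctPair_stepB

/-- `B₂` is the dual of `B₁`. -/
abbrev BasicBlockTwo : Type := BasicBlockOneᵒᵈ

/-! ### The classes and their cardinality -/

/-- `L` is a block with exactly `r` reducible elements, which are pairwise comparable, of nullity
`k`, and with associated basic block `B`. -/
def IsBlockWith (B : Type) [PartialOrder B] (r : ℕ) (k : ℤ) (L : Type) [Lattice L] : Prop :=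
  IsBlock L ∧ (redSet L).ncard = r ∧ IsChain (· ≤ ·) (redSet L) ∧ nullity L = k ∧
    IsAssociatedBasicBlock B L

/-- Isomorphism of lattice structures on `Fin j`. -/
def latticeIsoSetoid (j : ℕ) : Setoid (Lattice (Fin j)) where
  r I J := Nonempty (@OrderIso (Fin j) (Fin j) I.toLE J.toLE)
  iseqv :=
    { refl := fun I => ⟨@OrderIso.refl (Fin j) I.toLE⟩
      symm := fun {I J} ⟨e⟩ => ⟨@OrderIso.symm (Fin j) (Fin j) I.toLE J.toLE e⟩
      trans := fun {I J K} ⟨e⟩ ⟨f⟩ =>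
        ⟨@OrderIso.trans (Fin j) (Fin j) (Fin j) I.toLE J.toLE K.toLE e f⟩ }

/-- The number of isomorphism classes of lattices on `j` elements that are blocks with exactly `r`
reducible elements, pairwise comparable, nullity `k` and associated basic block `B`. -/
noncomputable def numBlocksWith (B : Type) [PartialOrder B] (j r : ℕ) (k : ℤ) : ℕ :=
  (Quotient.mk (latticeIsoSetoid j) ''
    {I : Lattice (Fin j) | @IsBlockWith B _ r k (Fin j) I}).ncard

/-- `P_n^k`: the number of partitions of `n` into `k` positive parts. -/
def numPartitions (n k : ℕ) : ℕ :=
  (Finset.univ.filter fun p : Nat.Partition n => p.parts.card = k).card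

/-- `L` has an adjunct representation `C₀ ]_a^1 C₁ ]_0^b C₂ ]_0^b C₃` where `C₁, C₂, C₃` are
nonempty chains and `C₀` is a maximal chain of `L` that contains all the reducible elements of `L`,
these being `0 < a < b < 1`. Chains are modelled by `Fin`. -/
def HasAdjunctRepresentation (L : Type) [Lattice L] : Prop :=
  ∃ (n₀ n₁ n₂ n₃ : ℕ) (a b : Fin (n₀ + 1)) (h₁ : IsAdjunctPair a (Fin.last n₀))
    (h₂ : IsAdjunctPair (Adjunct.inl 0 : Adjunct (Fin (n₀ + 1)) (Fin n₁) h₁) (Adjunct.inl b))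
    (h₃ : IsAdjunctPair (Adjunct.inl (Adjunct.inl 0) : Adjunct _ (Fin n₂) h₂)
      (Adjunct.inl (Adjunct.inl b)))
    (e : Adjunct _ (Fin n₃) h₃ ≃o L),
    0 < a ∧ a < b ∧ b < Fin.last n₀ ∧ 1 ≤ n₁ ∧ 1 ≤ n₂ ∧ 1 ≤ n₃ ∧
    IsMaxChain (· ≤ ·) (Set.range fun c => e (.inl (.inl (.inl c)))) ∧
    redSet L = (fun c => e (.inl (.inl (.inl c)))) '' {0, a, b, Fin.last n₀}

/-! ### Retractible elements -/

/-! All blocks in the class live inside one infinite lattice, `Ladder`: four nodes `0 < 1 < 2 < 3`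
for the reducible elements, joined by six edges that are copies of `ℚ`. A finite lattice belongs to
the class of `B₁` iff it order-embeds into `Ladder` with a good image, that is, a finite set with
all nodes and at least one point on each of the edges `1 → 3`, `0 → 2`, `0 → 2`
(`Ladder.isBlockWith_iff`).

To embed a block, start from the evident copy of `B₁` and undo the retractions: a retracted element
had nothing beside it between its two neighbours, so density of `ℚ` and the absence of end points
leave room for it on an edge (`Ladder.exists_insert`). Pendant vertices never arise, since the fork
at the bottom, and dually at the top, survives retraction. Conversely, a good set is closed under
joins and meets, its reducible elements are the nodes, its points can be retracted until one is left
on each of the last three edges, and counting covers gives nullity 3.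

A good set is determined up to isomorphism by its six fibre sizes, and the isomorphism type
determines these up to swapping the two parallel edges (`Ladder.ncard_fib_eq`). So the blocks on `j`
elements correspond to the tuples in `Ladder.edgeCounts`, which the triple sum counts. The nodes and
the first three edges form the chain `C₀`; the other fibres are `C₁`, `C₂`, `C₃`. The statement for
`B₂` follows by duality. -/

theorem exists_isDirectedPath {P : Type*} [PartialOrder P] [Finite P] {y z : P} (h : y ≤ z) :
    ∃ l : List P, IsDirectedPath (y :: l) y z := by
  classical
  have := Fintype.ofFinite P
  let _ : LocallyFiniteOrder P := Fintype.toLocallyFiniteOrder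
  obtain ⟨l, hl, hz⟩ :=
    List.exists_isChain_cons_of_relationReflTransGen (le_iff_reflTransGen_covBy.mp h)
  exact ⟨l, hl, rfl, by rw [List.getLast?_eq_some_getLast (List.cons_ne_nil _ _), hz]⟩

theorem IsDirectedPath.le {P : Type*} [PartialOrder P] {y z : P} :
    ∀ {l : List P}, IsDirectedPath l y z → y ≤ z
  | [], h => by simp [IsDirectedPath] at h
  | [w], h => by
    obtain ⟨-, h1, h2⟩ := h
    simp only [List.head?_cons, List.getLast?_singleton, Option.some.injEq] at h1 h2
    exact (h1.symm.trans h2).le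
  | w :: v :: l, h => by
    obtain ⟨h0, h1, h2⟩ := h
    rw [List.isChain_cons_cons] at h0
    simp only [List.head?_cons, Option.some.injEq] at h1
    rw [← h1]
    exact h0.1.le.trans (IsDirectedPath.le (l := v :: l) ⟨h0.2, rfl, by simpa using h2⟩)

/-- `x` has a unique lower cover `y` and a unique upper cover `z`, and the interval from `y` to `z`
has no elements besides `y`, `x` and `z`. -/
def IsRemovable {P : Type*} [PartialOrder P] (x : P) : Prop :=
  ∃ y z : P, y ⋖ x ∧ x ⋖ z ∧ (∀ w, w ⋖ x → w = y) ∧ (∀ w, x ⋖ w → w = z) ∧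
    ∀ w, y ≤ w → w ≤ z → w = y ∨ w = x ∨ w = z

/-- A covering path stays in the interval between its ends. Its second vertex cannot be `z`, because
`x` lies strictly between, so it is `x`; then `z` follows and the path stops. -/
theorem eq_of_isDirectedPath {P : Type*} [PartialOrder P] {x y z : P} (hyx : y ⋖ x) (hxz : x ⋖ z)
    (h : ∀ w, y ≤ w → w ≤ z → w = y ∨ w = x ∨ w = z) {l : List P} (hl : IsDirectedPath l y z) :
    l = [y, x, z] := by
  have hyz := hyx.lt.trans hxz.lt
  rcases l with _ | ⟨y', _ | ⟨w, l⟩⟩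
  · simp [IsDirectedPath] at hl
  · obtain ⟨-, h1, h2⟩ := hl
    simp only [List.head?_cons, List.getLast?_singleton, Option.some.injEq] at h1 h2
    exact absurd (h1.symm.trans h2) hyz.ne
  obtain ⟨h0, h1, h2⟩ := hl
  simp only [List.head?_cons, Option.some.injEq] at h1
  subst h1
  rw [List.isChain_cons_cons] at h0
  have hwz : w ≤ z := IsDirectedPath.le (l := w :: l) ⟨h0.2, rfl, by simpa using h2⟩
  obtain rfl : w = x := by
    rcases h w h0.1.le hwz with rfl | rfl | rfl
    · exact absurd h0.1.lt (lt_irrefl _)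
    · rfl
    · exact absurd hxz.lt (h0.1.2 hyx.lt)
  rcases l with _ | ⟨v, l⟩
  · simp only [List.getLast?_cons_cons, List.getLast?_singleton, Option.some.injEq] at h2
    exact absurd h2 hxz.ne
  rw [List.isChain_cons_cons] at h0
  obtain ⟨h3, h4, h5⟩ := h0
  have hvz : v ≤ z := IsDirectedPath.le (l := v :: l) ⟨h5, rfl, by simpa using h2⟩
  obtain rfl : v = z := hvz.eq_of_not_lt fun h6 => hxz.2 h4.lt h6
  rcases l with _ | ⟨u, l⟩
  · rfl
  rw [List.isChain_cons_cons] at h5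
  have huz : u ≤ v := IsDirectedPath.le (l := u :: l) ⟨h5.2, rfl, by simpa using h2⟩
  exact absurd h5.1.lt huz.not_gt

/-- A further element `w` between `y` and `z` would be incomparable to `x`. It would give `y` a
second upper cover and `z` a second lower cover, making both reducible, and also a second path from
`y` to `z`; this defeats both alternatives of retractibility. -/
theorem isRemovable_iff {P : Type*} [PartialOrder P] [Finite P] {x : P} :
    IsRemovable x ↔ IsIrrStar x ∧ IsRetractible x := by
  constructor
  · rintro ⟨y, z, hyx, hxz, hy, hz, h⟩
    refine ⟨⟨⟨z, hxz, hz⟩, ⟨y, hyx, hy⟩⟩, ⟨fun u hu v hv => (hz u hu).trans (hz v hv).symm,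
      fun u hu v hv => (hy u hu).trans (hy v hv).symm⟩, ?_⟩
    by_cases hr : ∃ y z : P, ¬ IsDoublyIrreducible y ∧ ¬ IsDoublyIrreducible z ∧ y ⋖ x ∧ x ⋖ z
    · right
      obtain ⟨y', z', h1, h2, h3, h4⟩ := hr
      obtain rfl := hy y' h3
      obtain rfl := hz z' h4
      exact ⟨y', z', h1, h2, h3, h4, fun l hl => eq_of_isDirectedPath h3 h4 h hl⟩
    · exact Or.inl hr
  · rintro ⟨⟨⟨z, hxz, hz⟩, ⟨y, hyx, hy⟩⟩, -, h⟩
    refine ⟨y, z, hyx, hxz, hy, hz, fun w hyw hwz => ?_⟩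
    by_contra! hw
    obtain ⟨hwy, hwx, hwz'⟩ := hw
    have hyw' := lt_of_le_of_ne hyw hwy.symm
    have hwz'' := lt_of_le_of_ne hwz hwz'
    obtain ⟨c, hyc, hcw⟩ := exists_covBy_le_of_lt hyw'
    obtain ⟨d, hwd, hdz⟩ := exists_le_covBy_of_lt hwz''
    have hxw : ¬ x ≤ w := fun h' => hxz.2 (lt_of_le_of_ne h' hwx.symm) hwz''
    have hwx' : ¬ w ≤ x := fun h' => hyx.2 hyw' (lt_of_le_of_ne h' hwx)
    rcases h with h | ⟨y', z', -, -, h3, h4, h5⟩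
    · refine h ⟨y, z, fun hi => ?_, fun hi => ?_, hyx, hxz⟩
      · exact hxw ((hi.1 hyc hyx : c = x) ▸ hcw)
      · exact hwx' ((hi.2 hdz hxz : d = x) ▸ hwd)
    · obtain rfl := hy y' h3
      obtain rfl := hz z' h4
      obtain ⟨l, hl⟩ := exists_isDirectedPath (hcw.trans hwz)
      have h6 := h5 (y' :: c :: l) ⟨List.isChain_cons_cons.mpr ⟨hyc, hl.1⟩, rfl, by
        simpa using hl.2.2⟩
      simp only [List.cons.injEq, true_and] at h6
      exact hxw (h6.1 ▸ hcw)

theorem isPendant_iff {P : Type*} [PartialOrder P] {x : P} :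
    IsPendant x ↔ ∃! y, x ⋖ y ∨ y ⋖ x := Iff.rfl

theorem IsRemovable.map {P Q : Type*} [PartialOrder P] [PartialOrder Q] (e : P ≃o Q) {x : P}
    (h : IsRemovable x) : IsRemovable (e x) := by
  obtain ⟨y, z, hyx, hxz, hy, hz, h⟩ := h
  refine ⟨e y, e z, (apply_covBy_apply_iff e).mpr hyx, (apply_covBy_apply_iff e).mpr hxz, ?_, ?_,
    ?_⟩ <;> refine e.surjective.forall.mpr fun w => ?_
  · simpa using hy w
  · simpa using hz w
  · simpa using h w

theorem IsRemovable.toDual {P : Type*} [PartialOrder P] {x : P} (h : IsRemovable x) :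
    IsRemovable (OrderDual.toDual x) := by
  obtain ⟨y, z, hyx, hxz, hy, hz, h⟩ := h
  refine ⟨OrderDual.toDual z, OrderDual.toDual y, hxz.toDual, hyx.toDual,
    fun w hw => hz (OrderDual.ofDual w) hw.ofDual, fun w hw => hy (OrderDual.ofDual w) hw.ofDual,
    fun w h1 h2 => ?_⟩
  rcases h (OrderDual.ofDual w) h2 h1 with h' | h' | h'
  · exact Or.inr (Or.inr h')
  · exact Or.inr (Or.inl h')
  · exact Or.inl h'

theorem IsPendant.map {P Q : Type*} [PartialOrder P] [PartialOrder Q] (e : P ≃o Q) {x : P}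
    (h : IsPendant x) : IsPendant (e x) := by
  obtain ⟨y, h1, h2⟩ := isPendant_iff.mp h
  refine isPendant_iff.mpr ⟨e y, by simpa using h1, e.surjective.forall.mpr fun w => ?_⟩
  simpa using h2 w

theorem IsPendant.toDual {P : Type*} [PartialOrder P] {x : P} (h : IsPendant x) :
    IsPendant (OrderDual.toDual x) := by
  obtain ⟨y, h1, h2⟩ := isPendant_iff.mp h
  refine isPendant_iff.mpr ⟨OrderDual.toDual y, h1.symm.imp CovBy.toDual CovBy.toDual,
    fun w hw => h2 (OrderDual.ofDual w) (hw.symm.imp CovBy.ofDual CovBy.ofDual)⟩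

theorem retractStep_iff {P : Type*} [PartialOrder P] {S T : Set P} [Finite S] :
    RetractStep S T ↔ ∃ x : S, IsRemovable x ∧ T = S \ {(x : P)} := by
  simp only [RetractStep, isRemovable_iff, and_assoc]

theorem isBasicRetract_iff {P : Type*} [PartialOrder P] [Finite P] :
    IsBasicRetract P ↔ ∀ x : P, ¬ IsRemovable x := by
  simp only [IsBasicRetract, isRemovable_iff, not_and]

theorem IsBasicRetract.map {P Q : Type*} [PartialOrder P] [PartialOrder Q] [Finite P] [Finite Q]
    (e : P ≃o Q) (h : IsBasicRetract P) : IsBasicRetract Q := by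
  rw [isBasicRetract_iff] at h ⊢
  exact fun x hx => h _ (hx.map e.symm)

/-- The part of the domain of an order embedding that it maps into a subset of its range. -/
noncomputable def OrderEmbedding.preimageIso {P Q : Type*} [PartialOrder P] [PartialOrder Q]
    (f : P ↪o Q) {S : Set Q} (hS : S ⊆ Set.range f) : ↥(f ⁻¹' S) ≃o S where
  toEquiv := Equiv.ofBijective (fun x => ⟨f x, x.2⟩)
    ⟨fun x y h => Subtype.ext (f.injective (congrArg Subtype.val h)), fun ⟨y, hy⟩ => by
      obtain ⟨x, rfl⟩ := hS hy
      exact ⟨⟨x, hy⟩, rfl⟩⟩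
  map_rel_iff' := f.le_iff_le

theorem RetractStep.subset {P : Type*} [PartialOrder P] {S T : Set P} (h : RetractStep S T) :
    T ⊆ S := by
  obtain ⟨x, -, -, rfl⟩ := h
  exact Set.sdiff_subset

/-- Removability depends only on the order of the subset, so retractions performed inside `Ladder`
can be pulled back to an embedded lattice. -/
theorem RetractStep.preimage {P Q : Type*} [PartialOrder P] [PartialOrder Q] [Finite P]
    (f : P ↪o Q) {S T : Set Q} (hS : S ⊆ Set.range f) (h : RetractStep S T) :
    RetractStep (f ⁻¹' S) (f ⁻¹' T) := by
  have : Finite S := (Set.finite_range f).subset hS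
  obtain ⟨x, hx, rfl⟩ := retractStep_iff.mp h
  refine retractStep_iff.mpr ⟨(f.preimageIso hS).symm x, hx.map _, ?_⟩
  have h1 : f ((f.preimageIso hS).symm x) = x :=
    congrArg Subtype.val ((f.preimageIso hS).apply_symm_apply x)
  ext w
  simp only [Set.mem_preimage, Set.mem_sdiff, Set.mem_singleton_iff]
  rw [← h1, f.injective.eq_iff]

theorem reflTransGen_retractStep_preimage {P Q : Type*} [PartialOrder P] [PartialOrder Q]
    [Finite P] (f : P ↪o Q) {S T : Set Q} (hS : S ⊆ Set.range f)
    (h : Relation.ReflTransGen RetractStep S T) :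
    T ⊆ S ∧ Relation.ReflTransGen RetractStep (f ⁻¹' S) (f ⁻¹' T) := by
  induction h with
  | refl => exact ⟨subset_rfl, .refl⟩
  | tail _ h2 ih =>
    exact ⟨h2.subset.trans ih.1, ih.2.tail (h2.preimage f (ih.1.trans hS))⟩

/-! ### Duality -/

/-- The dual of a subposet is a subposet of the dual. -/
def dualSubsetIso {P : Type*} [PartialOrder P] (S : Set P) :
    (↥S)ᵒᵈ ≃o ↥(OrderDual.ofDual ⁻¹' S) where
  toFun x := ⟨OrderDual.toDual (OrderDual.ofDual x).1, (OrderDual.ofDual x).2⟩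
  invFun x := OrderDual.toDual ⟨OrderDual.ofDual x.1, x.2⟩
  map_rel_iff' := Iff.rfl

theorem RetractStep.dual {P : Type*} [PartialOrder P] [Finite P] {S T : Set P}
    (h : RetractStep S T) : RetractStep (OrderDual.ofDual ⁻¹' S) (OrderDual.ofDual ⁻¹' T) := by
  have : Finite Pᵒᵈ := ‹Finite P›
  obtain ⟨x, hx, rfl⟩ := retractStep_iff.mp h
  exact retractStep_iff.mpr ⟨_, hx.toDual.map (dualSubsetIso S), rfl⟩

theorem PendantStep.dual {P : Type*} [PartialOrder P] {S T : Set P}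
    (h : PendantStep S T) : PendantStep (OrderDual.ofDual ⁻¹' S) (OrderDual.ofDual ⁻¹' T) := by
  obtain ⟨x, hx, rfl⟩ := h
  exact ⟨_, hx.toDual.map (dualSubsetIso S), rfl⟩

theorem IsAssociatedBasicBlock.dual {B P : Type*} [PartialOrder B] [PartialOrder P] [Finite P]
    (h : IsAssociatedBasicBlock B P) : IsAssociatedBasicBlock Bᵒᵈ Pᵒᵈ := by
  have : Finite Pᵒᵈ := ‹Finite P›
  obtain ⟨S, T, hS, hb, hT, hp, ⟨e⟩⟩ := h
  refine ⟨OrderDual.ofDual ⁻¹' S, OrderDual.ofDual ⁻¹' T,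
    hS.lift (fun S : Set P => OrderDual.ofDual ⁻¹' S) fun _ _ h => h.dual, ?_,
    hT.lift (fun S : Set P => OrderDual.ofDual ⁻¹' S) fun _ _ h => h.dual, ?_,
    ⟨e.dual.trans (dualSubsetIso T)⟩⟩
  · rw [isBasicRetract_iff] at hb ⊢
    exact fun x hx => hb _ (hx.map (dualSubsetIso S).symm).toDual
  · exact fun x hx => hp _ (hx.map (dualSubsetIso T).symm).toDual

theorem redSet_dual (L : Type*) [Lattice L] :
    redSet Lᵒᵈ = OrderDual.ofDual ⁻¹' redSet L := by
  ext a
  exact or_comm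

theorem IsBlock.dual {L : Type*} [Lattice L] (h : IsBlock L) : IsBlock Lᵒᵈ := by
  obtain ⟨⟨x, hx, hx'⟩, y, hy, hy'⟩ := h
  exact ⟨⟨OrderDual.toDual y, hy.toDual, hy'⟩, OrderDual.toDual x, hx.toDual, hx'⟩

theorem nullity_dual (P : Type*) [PartialOrder P] : nullity Pᵒᵈ = nullity P := by
  have h1 : Nat.card (SimpleGraph.hasse Pᵒᵈ).edgeSet = Nat.card (SimpleGraph.hasse P).edgeSet :=
    Nat.card_congr (SimpleGraph.hasseDualIso (α := P)).mapEdgeSet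
  have h2 : Nat.card (SimpleGraph.hasse Pᵒᵈ).ConnectedComponent =
      Nat.card (SimpleGraph.hasse P).ConnectedComponent :=
    Nat.card_congr (SimpleGraph.hasseDualIso (α := P)).connectedComponentEquiv
  have h3 : Nat.card Pᵒᵈ = Nat.card P := rfl
  rw [nullity, nullity, h1, h2, h3]

theorem IsBlockWith.dual {B : Type} [PartialOrder B] {r : ℕ} {k : ℤ} {L : Type} [Lattice L]
    [Finite L] (h : IsBlockWith B r k L) : IsBlockWith Bᵒᵈ r k Lᵒᵈ := by
  obtain ⟨h1, h2, h3, h4, h5⟩ := h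
  refine ⟨h1.dual, ?_, ?_, (nullity_dual L).trans h4, h5.dual⟩
  · rw [redSet_dual]
    exact h2
  · rw [redSet_dual]
    exact fun x hx y hy hxy => (h3 hx hy hxy).symm

theorem numBlocksWith_dual (B : Type) [PartialOrder B] (j r : ℕ) (k : ℤ) :
    numBlocksWith Bᵒᵈ j r k = numBlocksWith B j r k := by
  let d : Lattice (Fin j) → Lattice (Fin j) := fun I => @OrderDual.instLattice (Fin j) I
  have hd : ∀ I J : Lattice (Fin j), latticeIsoSetoid j I J → latticeIsoSetoid j (d I) (d J) :=
    fun I J ⟨e⟩ => ⟨@OrderIso.dual (Fin j) (Fin j) I.toLE J.toLE e⟩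
  let D : Quotient (latticeIsoSetoid j) → Quotient (latticeIsoSetoid j) := Quotient.map d hd
  -- The double dual of a lattice structure is definitionally the original one.
  have hD : Function.Involutive D := fun q => Quotient.inductionOn q fun I => rfl
  rw [numBlocksWith, numBlocksWith, ← Set.ncard_image_of_injective _ hD.injective,
    ← Set.image_comp]
  congr 1
  ext q
  constructor
  · rintro ⟨I, hI, rfl⟩
    exact ⟨d I, @IsBlockWith.dual Bᵒᵈ _ r k (Fin j) I _ hI, rfl⟩
  · rintro ⟨I, hI, rfl⟩
    exact ⟨d I, @IsBlockWith.dual B _ r k (Fin j) I _ hI, hD ⟦I⟧⟩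

/-! ### The ladder -/

/-- The lower ends of the six edges joining the nodes `0 < 1 < 2 < 3`. -/
def edgeSrc : Fin 6 → Fin 4 := ![0, 1, 2, 1, 0, 0]

/-- The upper ends of the six edges joining the nodes `0 < 1 < 2 < 3`. -/
def edgeTgt : Fin 6 → Fin 4 := ![1, 2, 3, 3, 2, 2]

theorem edgeSrc_lt_edgeTgt : ∀ e, edgeSrc e < edgeTgt e := by decide

/-- Four nodes `0 < 1 < 2 < 3` and, for each of the six edges `0 → 1`, `1 → 2`, `2 → 3`, `1 → 3`,
`0 → 2`, `0 → 2`, a copy of the rationals between its ends. -/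
inductive Ladder : Type
  | node : Fin 4 → Ladder
  | pt : Fin 6 → ℚ → Ladder

namespace Ladder

/-- The order of the ladder. -/
protected def le : Ladder → Ladder → Prop
  | .node i, .node k => i ≤ k
  | .node i, .pt e _ => i ≤ edgeSrc e
  | .pt e _, .node k => edgeTgt e ≤ k
  | .pt e p, .pt f q => edgeTgt e ≤ edgeSrc f ∨ e = f ∧ p ≤ q

instance : PartialOrder Ladder where
  le := Ladder.le
  le_refl x := by cases x <;> simp [Ladder.le]
  le_trans x y z hxy hyz := by
    rcases x with i | ⟨e, p⟩ <;> rcases y with k | ⟨f, q⟩ <;> rcases z with l | ⟨g, r⟩ <;>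
      simp only [Ladder.le] at hxy hyz ⊢
    · exact hxy.trans hyz
    · exact hxy.trans hyz
    · exact hxy.trans ((edgeSrc_lt_edgeTgt f).le.trans hyz)
    · rcases hyz with h | ⟨rfl, -⟩
      · exact hxy.trans ((edgeSrc_lt_edgeTgt f).le.trans h)
      · exact hxy
    · exact hxy.trans hyz
    · exact Or.inl (hxy.trans hyz)
    · rcases hxy with h | ⟨rfl, -⟩
      · exact h.trans ((edgeSrc_lt_edgeTgt f).le.trans hyz)
      · exact hyz
    · rcases hxy with h | ⟨rfl, h⟩ <;> rcases hyz with h' | ⟨rfl, h'⟩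
      · exact Or.inl (h.trans ((edgeSrc_lt_edgeTgt f).le.trans h'))
      · exact Or.inl h
      · exact Or.inl h'
      · exact Or.inr ⟨rfl, h.trans h'⟩
  le_antisymm x y hxy hyx := by
    rcases x with i | ⟨e, p⟩ <;> rcases y with k | ⟨f, q⟩ <;> simp only [Ladder.le] at hxy hyx
    · exact congrArg node (le_antisymm hxy hyx)
    · exact absurd (hyx.trans hxy) (edgeSrc_lt_edgeTgt f).not_ge
    · exact absurd (hxy.trans hyx) (edgeSrc_lt_edgeTgt e).not_ge
    · have he := edgeSrc_lt_edgeTgt e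
      have hf := edgeSrc_lt_edgeTgt f
      rcases hxy with h | ⟨rfl, h⟩ <;> rcases hyx with h' | ⟨h1, h'⟩
      · exact absurd (hf.trans_le (h'.trans he.le)) h.not_gt
      · exact absurd (h1 ▸ h) he.not_ge
      · exact absurd h' he.not_ge
      · exact congrArg (pt e) (le_antisymm h h')

@[simp] theorem node_le_node {i k : Fin 4} : node i ≤ node k ↔ i ≤ k := Iff.rfl

@[simp] theorem node_le_pt {i : Fin 4} {e : Fin 6} {p : ℚ} : node i ≤ pt e p ↔ i ≤ edgeSrc e :=
  Iff.rfl

@[simp] theorem pt_le_node {k : Fin 4} {e : Fin 6} {p : ℚ} : pt e p ≤ node k ↔ edgeTgt e ≤ k :=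
  Iff.rfl

theorem pt_le_pt {e f : Fin 6} {p q : ℚ} :
    pt e p ≤ pt f q ↔ edgeTgt e ≤ edgeSrc f ∨ e = f ∧ p ≤ q := Iff.rfl

@[simp] theorem pt_le_pt_self {e : Fin 6} {p q : ℚ} : pt e p ≤ pt e q ↔ p ≤ q := by
  simp [pt_le_pt, edgeSrc_lt_edgeTgt]

@[simp] theorem node_lt_node {i k : Fin 4} : node i < node k ↔ i < k := by
  rw [lt_iff_le_not_ge, lt_iff_le_not_ge]; simp

@[simp] theorem node_lt_pt {i : Fin 4} {e : Fin 6} {p : ℚ} : node i < pt e p ↔ i ≤ edgeSrc e := by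
  rw [lt_iff_le_not_ge, node_le_pt, pt_le_node, not_le, and_iff_left_iff_imp]
  exact fun h => h.trans_lt (edgeSrc_lt_edgeTgt e)

@[simp] theorem pt_lt_node {k : Fin 4} {e : Fin 6} {p : ℚ} : pt e p < node k ↔ edgeTgt e ≤ k := by
  rw [lt_iff_le_not_ge, node_le_pt, pt_le_node, not_le, and_iff_left_iff_imp]
  exact fun h => (edgeSrc_lt_edgeTgt e).trans_le h

@[simp] theorem pt_lt_pt_self {e : Fin 6} {p q : ℚ} : pt e p < pt e q ↔ p < q := by
  rw [lt_iff_le_not_ge, lt_iff_le_not_ge]; simp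

theorem pt_le_pt_of_ne {e f : Fin 6} {p q : ℚ} (h : e ≠ f) :
    pt e p ≤ pt f q ↔ edgeTgt e ≤ edgeSrc f := by simp [pt_le_pt, h]

/-- Joins in the ladder. -/
protected def sup : Ladder → Ladder → Ladder
  | .node i, .node k => .node (max i k)
  | .node i, .pt e p => if i ≤ edgeSrc e then .pt e p else .node (max i (edgeTgt e))
  | .pt e p, .node k => if k ≤ edgeSrc e then .pt e p else .node (max k (edgeTgt e))
  | .pt e p, .pt f q =>
    if e = f then .pt e (max p q) else if edgeTgt e ≤ edgeSrc f then .pt f q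
    else if edgeTgt f ≤ edgeSrc e then .pt e p else .node (max (edgeTgt e) (edgeTgt f))

/-- Meets in the ladder. -/
protected def inf : Ladder → Ladder → Ladder
  | .node i, .node k => .node (min i k)
  | .node i, .pt e p => if edgeTgt e ≤ i then .pt e p else .node (min i (edgeSrc e))
  | .pt e p, .node k => if edgeTgt e ≤ k then .pt e p else .node (min k (edgeSrc e))
  | .pt e p, .pt f q =>
    if e = f then .pt e (min p q) else if edgeTgt e ≤ edgeSrc f then .pt e p
    else if edgeTgt f ≤ edgeSrc e then .pt f q else .node (min (edgeSrc e) (edgeSrc f))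

/-- An element off the edge `e` is above a point of `e` only if it is above the target of `e`, and
below it only if it is below the source. As the nodes form a chain, joins and meets of incomparable
elements are therefore nodes. -/
instance : Lattice Ladder where
  sup := Ladder.sup
  inf := Ladder.inf
  le_sup_left x y := by
    rcases x with i | ⟨e, p⟩ <;> rcases y with k | ⟨f, q⟩ <;> simp only [Ladder.sup] <;>
      (try split_ifs) <;> simp_all [pt_le_pt]
  le_sup_right x y := by
    rcases x with i | ⟨e, p⟩ <;> rcases y with k | ⟨f, q⟩ <;> simp only [Ladder.sup] <;>
      (try split_ifs) <;> simp_all [pt_le_pt]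
  sup_le x y z hx hy := by
    rcases x with i | ⟨e, p⟩ <;> rcases y with k | ⟨f, q⟩ <;> rcases z with l | ⟨g, r⟩ <;>
      simp only [Ladder.sup] <;> (try split_ifs) <;> simp_all [pt_le_pt] <;> grind
  inf_le_left x y := by
    rcases x with i | ⟨e, p⟩ <;> rcases y with k | ⟨f, q⟩ <;> simp only [Ladder.inf] <;>
      (try split_ifs) <;> simp_all [pt_le_pt]
  inf_le_right x y := by
    rcases x with i | ⟨e, p⟩ <;> rcases y with k | ⟨f, q⟩ <;> simp only [Ladder.inf] <;>
      (try split_ifs) <;> simp_all [pt_le_pt]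
  le_inf x y z hx hy := by
    rcases x with i | ⟨e, p⟩ <;> rcases y with k | ⟨f, q⟩ <;> rcases z with l | ⟨g, r⟩ <;>
      simp only [Ladder.inf] <;> (try split_ifs) <;> simp_all [pt_le_pt] <;> grind

theorem pt_sup_node (e : Fin 6) (p : ℚ) (k : Fin 4) : pt e p ⊔ node k =
    if k ≤ edgeSrc e then .pt e p else .node (max k (edgeTgt e)) := rfl

theorem pt_inf_node (e : Fin 6) (p : ℚ) (k : Fin 4) : pt e p ⊓ node k =
    if edgeTgt e ≤ k then .pt e p else .node (min k (edgeSrc e)) := rfl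

theorem pt_sup_pt (e f : Fin 6) (p q : ℚ) : pt e p ⊔ pt f q =
    if e = f then .pt e (max p q) else if edgeTgt e ≤ edgeSrc f then .pt f q
    else if edgeTgt f ≤ edgeSrc e then .pt e p else .node (max (edgeTgt e) (edgeTgt f)) := rfl

theorem pt_inf_pt (e f : Fin 6) (p q : ℚ) : pt e p ⊓ pt f q =
    if e = f then .pt e (min p q) else if edgeTgt e ≤ edgeSrc f then .pt e p
    else if edgeTgt f ≤ edgeSrc e then .pt f q else .node (min (edgeSrc e) (edgeSrc f)) := rfl

/-- This gives both that any set containing the nodes is closed under joins and that no point of an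
edge is a join of two other elements. -/
theorem sup_eq (x y : Ladder) : x ⊔ y = x ∨ x ⊔ y = y ∨ ∃ i, x ⊔ y = node i := by
  rcases x with i | ⟨e, p⟩ <;> rcases y with k | ⟨f, q⟩
  · exact Or.inr (Or.inr ⟨_, rfl⟩)
  · rw [sup_comm, pt_sup_node]; split_ifs <;> simp
  · rw [pt_sup_node]; split_ifs <;> simp
  · rw [pt_sup_pt]; split_ifs with h <;> simp [h]; exact le_total _ _

theorem inf_eq (x y : Ladder) : x ⊓ y = x ∨ x ⊓ y = y ∨ ∃ i, x ⊓ y = node i := by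
  rcases x with i | ⟨e, p⟩ <;> rcases y with k | ⟨f, q⟩
  · exact Or.inr (Or.inr ⟨_, rfl⟩)
  · rw [inf_comm, pt_inf_node]; split_ifs <;> simp
  · rw [pt_inf_node]; split_ifs <;> simp
  · rw [pt_inf_pt]; split_ifs with h <;> simp [h]; exact le_total _ _

/-- A finite set that contains all the nodes and points of the edges `1 → 3`, `0 → 2`, `0 → 2`. -/
structure IsGood (A : Set Ladder) : Prop where
  finite : A.Finite
  node_mem : ∀ i, node i ∈ A
  exists_pt : ∀ e : Fin 6, 3 ≤ e → ∃ p, pt e p ∈ A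

theorem IsGood.sup_mem {A : Set Ladder} (hA : IsGood A) {x y : Ladder} (hx : x ∈ A) (hy : y ∈ A) :
    x ⊔ y ∈ A := by
  rcases sup_eq x y with h | h | ⟨i, h⟩ <;> rw [h]
  exacts [hx, hy, hA.node_mem i]

theorem IsGood.inf_mem {A : Set Ladder} (hA : IsGood A) {x y : Ladder} (hx : x ∈ A) (hy : y ∈ A) :
    x ⊓ y ∈ A := by
  rcases inf_eq x y with h | h | ⟨i, h⟩ <;> rw [h]
  exacts [hx, hy, hA.node_mem i]

/-! ### Reducible elements of lattices with good image -/

/-- The join taken in `Ladder` lies in the range, so it is also the join there; an order embedding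
is thus automatically a lattice homomorphism. -/
theorem map_sup_of_isGood {L : Type*} [Lattice L] (f : L ↪o Ladder) (hf : IsGood (Set.range f))
    (x y : L) : f (x ⊔ y) = f x ⊔ f y := by
  refine le_antisymm ?_ (sup_le (f.monotone le_sup_left) (f.monotone le_sup_right))
  obtain ⟨z, hz⟩ := hf.sup_mem (Set.mem_range_self x) (Set.mem_range_self y)
  rw [← hz, f.le_iff_le]
  exact sup_le (f.le_iff_le.mp (hz ▸ le_sup_left)) (f.le_iff_le.mp (hz ▸ le_sup_right))

theorem map_inf_of_isGood {L : Type*} [Lattice L] (f : L ↪o Ladder) (hf : IsGood (Set.range f))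
    (x y : L) : f (x ⊓ y) = f x ⊓ f y := by
  refine le_antisymm (le_inf (f.monotone inf_le_left) (f.monotone inf_le_right)) ?_
  obtain ⟨z, hz⟩ := hf.inf_mem (Set.mem_range_self x) (Set.mem_range_self y)
  rw [← hz, f.le_iff_le]
  exact le_inf (f.le_iff_le.mp (hz ▸ inf_le_left)) (f.le_iff_le.mp (hz ▸ inf_le_right))

/-- The witnesses are another node `k` and a point of an edge `e` that is guaranteed to be occupied.
In this way node 0 is the meet of node 1 with a point of edge 4, and node 1 that of node 2 with a
point of edge 3. -/
theorem isMeetReducible_of_map {L : Type*} [Lattice L] (f : L ↪o Ladder)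
    (hf : IsGood (Set.range f)) {x : L} {i k : Fin 4} {e : Fin 6} (hx : f x = node i) (he : 3 ≤ e)
    (hk : k ≠ i) (h1 : ¬ edgeTgt e ≤ k) (h2 : min k (edgeSrc e) = i) : IsMeetReducible x := by
  obtain ⟨p, y, hy⟩ := hf.exists_pt e he
  obtain ⟨z, hz⟩ := hf.node_mem k
  refine ⟨y, z, fun h => ?_, fun h => ?_, f.injective ?_⟩
  · rw [h, hx] at hy; simp at hy
  · rw [h, hx] at hz; simp at hz; exact hk hz.symm
  · rw [map_inf_of_isGood f hf, hy, hz, hx, pt_inf_node, if_neg h1, h2]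

theorem isJoinReducible_of_map {L : Type*} [Lattice L] (f : L ↪o Ladder)
    (hf : IsGood (Set.range f)) {x : L} {i k : Fin 4} {e : Fin 6} (hx : f x = node i) (he : 3 ≤ e)
    (hk : k ≠ i) (h1 : ¬ k ≤ edgeSrc e) (h2 : max k (edgeTgt e) = i) : IsJoinReducible x := by
  obtain ⟨p, y, hy⟩ := hf.exists_pt e he
  obtain ⟨z, hz⟩ := hf.node_mem k
  refine ⟨y, z, fun h => ?_, fun h => ?_, f.injective ?_⟩
  · rw [h, hx] at hy; simp at hy
  · rw [h, hx] at hz; simp at hz; exact hk hz.symm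
  · rw [map_sup_of_isGood f hf, hy, hz, hx, pt_sup_node, if_neg h1, h2]

theorem isMeetReducible_zero {L : Type*} [Lattice L] (f : L ↪o Ladder)
    (hf : IsGood (Set.range f)) {x : L} (hx : f x = node 0) : IsMeetReducible x :=
  isMeetReducible_of_map f hf (k := 1) (e := 4) hx (by decide) (by decide) (by decide) (by decide)

theorem isJoinReducible_three {L : Type*} [Lattice L] (f : L ↪o Ladder)
    (hf : IsGood (Set.range f)) {x : L} (hx : f x = node 3) : IsJoinReducible x :=
  isJoinReducible_of_map f hf (k := 2) (e := 3) hx (by decide) (by decide) (by decide) (by decide)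

theorem mem_redSet_iff_of_isGood {L : Type*} [Lattice L] (f : L ↪o Ladder)
    (hf : IsGood (Set.range f)) (x : L) : x ∈ redSet L ↔ ∃ i, f x = node i := by
  constructor
  · rintro (⟨b, c, hb, hc, h⟩ | ⟨b, c, hb, hc, h⟩)
    · have h' := map_inf_of_isGood f hf b c
      rw [h] at h'
      rcases inf_eq (f b) (f c) with h1 | h1 | ⟨i, h1⟩ <;> rw [h1] at h'
      exacts [absurd (f.injective h').symm hb, absurd (f.injective h').symm hc, ⟨i, h'⟩]
    · have h' := map_sup_of_isGood f hf b c
      rw [h] at h'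
      rcases sup_eq (f b) (f c) with h1 | h1 | ⟨i, h1⟩ <;> rw [h1] at h'
      exacts [absurd (f.injective h').symm hb, absurd (f.injective h').symm hc, ⟨i, h'⟩]
  · rintro ⟨i, hi⟩
    fin_cases i
    · exact Or.inl (isMeetReducible_zero f hf hi)
    · exact Or.inl (isMeetReducible_of_map f hf (k := 2) (e := 3) hi (by decide) (by decide)
        (by decide) (by decide))
    · exact Or.inr (isJoinReducible_of_map f hf (k := 1) (e := 4) hi (by decide) (by decide)
        (by decide) (by decide))
    · exact Or.inr (isJoinReducible_three f hf hi)

theorem node_zero_le (x : Ladder) : node 0 ≤ x := by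
  cases x <;> simp

theorem le_node_three (x : Ladder) : x ≤ node 3 := by
  cases x <;> exact Fin.le_last _

theorem isBlock_of_isGood {L : Type*} [Lattice L] (f : L ↪o Ladder)
    (hf : IsGood (Set.range f)) : IsBlock L := by
  obtain ⟨x, hx⟩ := hf.node_mem 0
  obtain ⟨y, hy⟩ := hf.node_mem 3
  refine ⟨⟨x, fun z => f.le_iff_le.mp ?_, isMeetReducible_zero f hf hx⟩, y,
    fun z => f.le_iff_le.mp ?_, isJoinReducible_three f hf hy⟩
  · rw [hx]; exact node_zero_le _
  · rw [hy]; exact le_node_three _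

theorem image_redSet_of_isGood {L : Type*} [Lattice L] (f : L ↪o Ladder)
    (hf : IsGood (Set.range f)) : f '' redSet L = Set.range node := by
  ext w
  constructor
  · rintro ⟨x, hx, rfl⟩
    obtain ⟨i, hi⟩ := (mem_redSet_iff_of_isGood f hf x).mp hx
    exact ⟨i, hi.symm⟩
  · rintro ⟨i, rfl⟩
    obtain ⟨x, hx⟩ := hf.node_mem i
    exact ⟨x, (mem_redSet_iff_of_isGood f hf x).mpr ⟨i, hx⟩, hx⟩

theorem node_injective : Function.Injective node := fun _ _ h => node.inj h

theorem ncard_redSet_of_isGood {L : Type*} [Lattice L] (f : L ↪o Ladder)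
    (hf : IsGood (Set.range f)) : (redSet L).ncard = 4 := by
  rw [← Set.ncard_image_of_injective _ f.injective, image_redSet_of_isGood f hf,
    ← Set.image_univ, Set.ncard_image_of_injective _ node_injective, Set.ncard_univ, Nat.card_fin]

theorem isChain_redSet_of_isGood {L : Type*} [Lattice L] (f : L ↪o Ladder)
    (hf : IsGood (Set.range f)) : IsChain (· ≤ ·) (redSet L) := by
  intro x hx y hy _
  obtain ⟨i, hi⟩ := (mem_redSet_iff_of_isGood f hf x).mp hx
  obtain ⟨k, hk⟩ := (mem_redSet_iff_of_isGood f hf y).mp hy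
  change x ≤ y ∨ y ≤ x
  rw [← f.le_iff_le, ← f.le_iff_le, hi, hk]
  exact le_total i k

end Ladder

namespace Ladder

/-! ### Blocks whose basic block is `B₁` embed into the ladder -/

theorem edge_eq_of_le : ∀ {e f : Fin 6}, e < 3 → edgeSrc e ≤ edgeSrc f → edgeTgt f ≤ edgeTgt e →
    f = e := by decide

theorem exists_edge_of_succ : ∀ {i k : Fin 4}, i < k → (∀ l, i ≤ l → l ≤ k → l = i ∨ l = k) →
    ∃ e : Fin 6, e < 3 ∧ edgeSrc e = i ∧ edgeTgt e = k := by decide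

/-- Two elements with nothing of `A` between them lie on a common edge: otherwise a node would
intervene. A position between them on that edge compares with `A` as required. -/
theorem exists_insert {A : Set Ladder} (hA : ∀ i, node i ∈ A) {a b : Ladder} (ha : a ∈ A)
    (hb : b ∈ A) (hab : a < b) (h : ∀ w ∈ A, a ≤ w → w ≤ b → w = a ∨ w = b) :
    ∃ u, (∀ w ∈ A, w ≤ u ↔ w ≤ a) ∧ ∀ w ∈ A, u ≤ w ↔ b ≤ w := by
  rcases a with i | ⟨e, p⟩ <;> rcases b with k | ⟨f, q⟩
  · obtain ⟨e, he, rfl, rfl⟩ := exists_edge_of_succ (node_lt_node.mp hab) fun l h1 h2 => by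
      simpa using h (node l) (hA l) (by simpa) (by simpa)
    -- The edge carries no point of `A`, so any position would do.
    refine ⟨pt e 0, fun w hw => ?_, fun w hw => ?_⟩ <;> rcases w with l | ⟨f, q⟩ <;>
      simp only [node_le_pt, node_le_node, pt_le_node, pt_le_pt]
    · rw [or_iff_left]
      rintro ⟨rfl, -⟩
      simpa using h _ hw (by simp) (by simp)
    · rw [or_iff_left]
      rintro ⟨rfl, -⟩
      simpa using h _ hw (by simp) (by simp)
  · obtain rfl : i = edgeSrc f := by
      have h1 := node_lt_pt.mp hab
      have := h (node (edgeSrc f)) (hA _) (by simpa) (by simp)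
      simp only [node.injEq, reduceCtorEq, or_false] at this
      exact this.symm
    have hq : ∀ r, pt f r ∈ A → q ≤ r := fun r hr => by
      by_contra! hlt
      have := h _ hr (by simp) (by simpa using hlt.le)
      simp only [reduceCtorEq, pt.injEq, true_and, false_or] at this
      exact hlt.ne this
    have hf := edgeSrc_lt_edgeTgt f
    -- Here `q` is the lowest occupied position on `f`; anything below it works since `ℚ` has no
    -- least element.
    refine ⟨pt f (q - 1), fun w hw => ?_, fun w hw => ?_⟩ <;> rcases w with l | ⟨g, r⟩ <;>
      simp only [node_le_pt, node_le_node, pt_le_node, pt_le_pt]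
    · rw [or_iff_left]
      rintro ⟨rfl, hr⟩
      linarith [hq r hw]
    · refine or_congr_right (and_congr_right ?_)
      rintro rfl
      exact ⟨fun _ => hq r hw, fun h => by linarith⟩
  · obtain rfl : k = edgeTgt e := by
      have h1 := pt_lt_node.mp hab
      have := h (node (edgeTgt e)) (hA _) (by simp) (by simpa)
      simp only [node.injEq, reduceCtorEq, false_or] at this
      exact this.symm
    have hp : ∀ r, pt e r ∈ A → r ≤ p := fun r hr => by
      by_contra! hlt
      have := h _ hr (by simpa using hlt.le) (by simp)
      simp only [reduceCtorEq, pt.injEq, true_and, or_false] at this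
      exact hlt.ne this.symm
    refine ⟨pt e (p + 1), fun w hw => ?_, fun w hw => ?_⟩ <;> rcases w with l | ⟨g, r⟩ <;>
      simp only [node_le_pt, node_le_node, pt_le_node, pt_le_pt]
    · refine or_congr_right (and_congr_right ?_)
      rintro rfl
      exact ⟨fun _ => hp r hw, fun h => by linarith⟩
    · rw [or_iff_left]
      rintro ⟨rfl, hr⟩
      linarith [hp r hw]
  · obtain rfl : e = f := by
      by_contra hef
      have h1 := (pt_le_pt_of_ne hef).mp hab.le
      simpa using h (node (edgeTgt e)) (hA _) (by simp) (by simpa)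
    have hpq : p < q := by simpa using hab
    have hr' : ∀ r, pt e r ∈ A → r ≤ p ∨ q ≤ r := fun r hr => by
      by_contra! hlt
      have := h _ hr (by simpa using hlt.1.le) (by simpa using hlt.2.le)
      simp only [pt.injEq, true_and] at this
      exact this.elim hlt.1.ne' hlt.2.ne
    refine ⟨pt e ((p + q) / 2), fun w hw => ?_, fun w hw => ?_⟩ <;> rcases w with l | ⟨g, r⟩ <;>
      simp only [node_le_pt, pt_le_node, pt_le_pt] <;>
      refine or_congr_right (and_congr_right ?_) <;> rintro rfl
    · exact ⟨fun h => (hr' r hw).resolve_right fun h' => by linarith, fun h => by linarith⟩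
    · exact ⟨fun h => (hr' r hw).resolve_left fun h' => by linarith, fun h => by linarith⟩

theorem IsGood.insert {A : Set Ladder} (hA : IsGood A) (u : Ladder) : IsGood (insert u A) :=
  ⟨hA.finite.insert u, fun i => Or.inr (hA.node_mem i), fun e he =>
    (hA.exists_pt e he).imp fun _ h => Or.inr h⟩

/-- The elements below `x` other than `x` are those below `y`, and those above it are the ones above
`z`. Sending `x` to the position supplied by `exists_insert` for the images of `y` and `z` therefore
preserves and reflects the order. -/
theorem exists_embedding_of_isRemovable {P : Type*} [PartialOrder P] [Finite P] {S : Set P} {x : S}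
    (hx : IsRemovable x) (f : ↥(S \ {(x : P)}) ↪o Ladder) (hf : IsGood (Set.range f)) :
    ∃ g : S ↪o Ladder, IsGood (Set.range g) := by
  classical
  obtain ⟨y, z, hyx, hxz, hy, hz, h⟩ := hx
  let r : ∀ w : S, w ≠ x → ↥(S \ {(x : P)}) := fun w hw => ⟨w, w.2, fun h => hw (Subtype.ext h)⟩
  have hr : ∀ w, ∃ v, ∃ hv : v ≠ x, r v hv = w := fun ⟨w, hw, hw'⟩ =>
    ⟨⟨w, hw⟩, fun h => hw' (congrArg Subtype.val h), rfl⟩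
  have hle : ∀ v w hv hw, f (r v hv) ≤ f (r w hw) ↔ v ≤ w := fun v w hv hw => f.le_iff_le
  have h1 : ∀ w, w ≠ x → (w ≤ x ↔ w ≤ y) := fun w hw => by
    refine ⟨fun h => ?_, fun h => h.trans hyx.le⟩
    obtain ⟨c, hwc, hc⟩ := exists_le_covBy_of_lt (lt_of_le_of_ne h hw)
    exact hy c hc ▸ hwc
  have h2 : ∀ w, w ≠ x → (x ≤ w ↔ z ≤ w) := fun w hw => by
    refine ⟨fun h => ?_, fun h => hxz.le.trans h⟩
    obtain ⟨c, hwc, hc⟩ := exists_covBy_le_of_lt (lt_of_le_of_ne h hw.symm)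
    exact hz c hwc ▸ hc
  obtain ⟨u, hu1, hu2⟩ := exists_insert hf.node_mem (Set.mem_range_self (r y hyx.ne))
    (Set.mem_range_self (r z hxz.ne')) (f.lt_iff_lt.mpr (hyx.lt.trans hxz.lt)) (by
      rintro _ ⟨w, rfl⟩ h3 h4
      obtain ⟨v, hv, rfl⟩ := hr w
      rcases h v ((hle y v hyx.ne hv).mp h3) ((hle v z hv hxz.ne').mp h4) with rfl | rfl | rfl
      · exact Or.inl rfl
      · exact absurd rfl hv
      · exact Or.inr rfl)
  let g : S → Ladder := fun w => if hw : w = x then u else f (r w hw)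
  have hgx : g x = u := dif_pos rfl
  have hg : ∀ w (hw : w ≠ x), g w = f (r w hw) := fun w hw => dif_neg hw
  refine ⟨OrderEmbedding.ofMapLEIff g fun v w => ?_, ?_⟩
  · by_cases hv : v = x <;> by_cases hw : w = x
    · rw [hv, hw]; simp
    · rw [hv, hgx, hg w hw, hu2 _ (Set.mem_range_self _), hle z w hxz.ne' hw, h2 w hw]
    · rw [hw, hgx, hg v hv, hu1 _ (Set.mem_range_self _), hle v y hv hyx.ne, h1 v hv]
    · rw [hg v hv, hg w hw, hle v w hv hw]
  · convert hf.insert u using 1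
    ext w
    simp only [OrderEmbedding.coe_ofMapLEIff, Set.mem_range, Set.mem_insert_iff]
    constructor
    · rintro ⟨v, rfl⟩
      by_cases hv : v = x
      · exact Or.inl (hv ▸ hgx)
      · exact Or.inr ⟨r v hv, (hg v hv).symm⟩
    · rintro (rfl | ⟨v, rfl⟩)
      · exact ⟨x, hgx⟩
      · obtain ⟨v, hv, rfl⟩ := hr v
        exact ⟨v, hg v hv⟩

theorem exists_embedding_of_reflTransGen {P : Type*} [PartialOrder P] [Finite P] {S T : Set P}
    (h : Relation.ReflTransGen RetractStep S T)
    (hT : ∃ g : T ↪o Ladder, IsGood (Set.range g)) : ∃ g : S ↪o Ladder, IsGood (Set.range g) := by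
  induction h using Relation.ReflTransGen.head_induction_on with
  | refl => exact hT
  | head h1 _ ih =>
    obtain ⟨x, hx, rfl⟩ := retractStep_iff.mp h1
    obtain ⟨g, hg⟩ := ih
    exact exists_embedding_of_isRemovable hx g hg

instance {L₁ L₂ : Type} [PartialOrder L₁] [Finite L₁] [Finite L₂] {a b : L₁}
    (h : IsAdjunctPair a b) : Finite (Adjunct L₁ L₂ h) :=
  Finite.of_surjective (Sum.elim Adjunct.inl Adjunct.inr) (by
    rintro (x | x)
    exacts [⟨.inl x, rfl⟩, ⟨.inr x, rfl⟩])

/-- The position of the elements of `B₁` in the ladder. -/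
def ofBasicBlockOne : BasicBlockOne → Ladder
  | .inl (.inl (.inl i)) => node i
  | .inl (.inl (.inr _)) => pt 3 0
  | .inl (.inr _) => pt 4 0
  | .inr _ => pt 5 0

/-- The embedding of `B₁` into the ladder. -/
def basicBlockOneEmbedding : BasicBlockOne ↪o Ladder :=
  OrderEmbedding.ofMapLEIff ofBasicBlockOne (by
    have h (e : Fin 6) (i k : Fin 1) : pt e 0 ≤ pt e 0 ↔ i ≤ k :=
      iff_of_true le_rfl (Subsingleton.elim i k).le
    have h' {e f : Fin 6} {l m : Fin 4} (hef : e ≠ f) (h1 : ¬ edgeTgt e ≤ edgeSrc f)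
        (h2 : ¬ l ≤ m) : pt e 0 ≤ pt f 0 ↔ l ≤ m :=
      iff_of_false (by rwa [pt_le_pt_of_ne hef]) h2
    rintro (((i | i) | i) | i) (((k | k) | k) | k)
    -- Of the sixteen pairs of constructors, the three diagonal pairs of points compare inside a
    -- one-element chain, and the six mixed pairs of points unfold on the `B₁` side to false
    -- inequalities between nodes. The rest agree by definition.
    on_goal 6 => exact h _ _ _
    on_goal 10 => exact h _ _ _
    on_goal 14 => exact h _ _ _
    on_goal 6 => exact h' (l := 3) (m := 0) (by decide) (by decide) (by decide)
    on_goal 6 => exact h' (l := 3) (m := 0) (by decide) (by decide) (by decide)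
    on_goal 7 => exact h' (l := 2) (m := 1) (by decide) (by decide) (by decide)
    on_goal 7 => exact h' (l := 2) (m := 0) (by decide) (by decide) (by decide)
    on_goal 8 => exact h' (l := 2) (m := 1) (by decide) (by decide) (by decide)
    on_goal 8 => exact h' (l := 2) (m := 0) (by decide) (by decide) (by decide)
    all_goals exact Iff.rfl)

theorem isGood_range_basicBlockOneEmbedding : IsGood (Set.range basicBlockOneEmbedding) := by
  refine ⟨?_, fun i => ⟨.inl (.inl (.inl i)), rfl⟩, fun e he => ⟨0, ?_⟩⟩
  · exact Set.finite_range _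
  · obtain rfl | rfl | rfl : e = 3 ∨ e = 4 ∨ e = 5 := by revert e; decide
    · exact ⟨.inl (.inl (.inr 0)), rfl⟩
    · exact ⟨.inl (.inr 0), rfl⟩
    · exact ⟨.inr 0, rfl⟩

/-! ### No pendant vertices -/

/-- In `S` the element `o` is least and has at least two upper covers. -/
def HasForkedBot {P : Type*} [PartialOrder P] (S : Set P) (o : P) : Prop :=
  ∃ o' : S, o'.1 = o ∧ (∀ x : S, o' ≤ x) ∧ ∃ c d : S, c ≠ d ∧ o' ⋖ c ∧ o' ⋖ d

/-- If an upper cover `x` of the bottom is removed, then `z` takes its place as an upper cover. It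
cannot merge with the other cover `d`, for `x < z = d` would contradict that `d` covers the bottom.
-/
theorem HasForkedBot.diff {P : Type*} [PartialOrder P] {S : Set P} {x : S} {o : P}
    (hx : IsRemovable x) (h : HasForkedBot S o) : HasForkedBot (S \ {(x : P)}) o := by
  obtain ⟨y, z, hyx, hxz, hy, hz, h'⟩ := hx
  obtain ⟨o, rfl, ho, c, d, hcd, hc, hd⟩ := h
  have hox : o ≠ x := by
    rintro rfl
    exact hyx.lt.not_ge (ho y)
  let r : ∀ w : S, w ≠ x → ↥(S \ {(x : P)}) := fun w hw => ⟨w, w.2, fun h => hw (Subtype.ext h)⟩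
  have hr : ∀ w, ∃ v, ∃ hv : v ≠ x, r v hv = w := fun ⟨w, hw, hw'⟩ =>
    ⟨⟨w, hw⟩, fun h => hw' (congrArg Subtype.val h), rfl⟩
  have hcov : ∀ w hw, o ⋖ w → r o hox ⋖ r w hw := fun w hw h =>
    ⟨h.lt, fun v hv hvw => by
      obtain ⟨v, hv', rfl⟩ := hr v
      exact h.2 (c := v) hv hvw⟩
  have key : ∀ c d : S, c ≠ d → o ⋖ c → o ⋖ d → d ≠ x →
      ∃ c d : ↥(S \ {(x : P)}), c ≠ d ∧ r o hox ⋖ c ∧ r o hox ⋖ d := by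
    intro c d hcd hc hd hdx
    by_cases hcx : c = x
    · subst hcx
      obtain rfl := hy o hc
      refine ⟨r z hxz.ne', r d hdx, fun h => ?_, ⟨hyx.lt.trans hxz.lt, fun v hv hvz => ?_⟩,
        hcov d hdx hd⟩
      · have hzd : z = d := Subtype.ext (congrArg (fun v => v.1) h)
        exact hd.2 hc.lt (hzd ▸ hxz.lt)
      · obtain ⟨v, hv', rfl⟩ := hr v
        rcases h' v hv.le hvz.le with rfl | rfl | rfl
        exacts [lt_irrefl _ hv, hv' rfl, lt_irrefl _ hvz]
    · exact ⟨r c hcx, r d hdx, fun h => hcd (Subtype.ext (congrArg (fun v => v.1) h)), hcov c hcx hc,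
        hcov d hdx hd⟩
  refine ⟨r o hox, rfl, fun w => ?_, ?_⟩
  · obtain ⟨w, hw, rfl⟩ := hr w
    exact ho w
  · by_cases hdx : d = x
    · exact key d c hcd.symm hd hc fun h => hcd (h.trans hdx.symm)
    · exact key c d hcd hc hd hdx

theorem HasForkedBot.reflTransGen {P : Type*} [PartialOrder P] [Finite P] {S T : Set P} {o : P}
    (h : Relation.ReflTransGen RetractStep S T) (hS : HasForkedBot S o) : HasForkedBot T o := by
  induction h with
  | refl => exact hS
  | tail _ h ih =>
    obtain ⟨x, hx, rfl⟩ := retractStep_iff.mp h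
    exact ih.diff hx

theorem hasForkedBot_univ {L : Type*} [Lattice L] [Finite L] {o : L} (ho : IsBot o)
    (h : IsMeetReducible o) : HasForkedBot Set.univ o := by
  obtain ⟨b, c, hb, hc, h⟩ := h
  have hcov : ∀ w, o ⋖ w → (⟨o, trivial⟩ : (Set.univ : Set L)) ⋖ ⟨w, trivial⟩ := fun w hw =>
    ⟨hw.lt, fun v hv hvw => hw.2 (c := v.1) hv hvw⟩
  obtain ⟨x, hx, hxb⟩ := exists_covBy_le_of_lt (lt_of_le_of_ne (ho b) hb.symm)
  obtain ⟨y, hy, hyc⟩ := exists_covBy_le_of_lt (lt_of_le_of_ne (ho c) hc.symm)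
  refine ⟨⟨o, trivial⟩, rfl, fun w => ho w, ⟨x, trivial⟩, ⟨y, trivial⟩, fun hxy => ?_, hcov x hx,
    hcov y hy⟩
  obtain rfl : x = y := congrArg Subtype.val hxy
  exact absurd (h ▸ le_inf hxb hyc) hx.lt.not_ge

/-- Every element other than the two extremes has a neighbour below and one above, and the extremes
are forked. -/
theorem not_isPendant_of_forked {P : Type*} [PartialOrder P] [Finite P] {o i : P}
    (ho : ∀ x, o ≤ x) (hi : ∀ x, x ≤ i) (hoc : ∃ c d : P, c ≠ d ∧ o ⋖ c ∧ o ⋖ d)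
    (hic : ∃ c d : P, c ≠ d ∧ c ⋖ i ∧ d ⋖ i) (x : P) : ¬ IsPendant x := by
  rintro ⟨y, -, hy⟩
  have key : ∀ c d, c ≠ d → (x ⋖ c ∨ c ⋖ x) → (x ⋖ d ∨ d ⋖ x) → False := fun c d hcd hc hd =>
    hcd ((hy c hc).trans (hy d hd).symm)
  by_cases hxo : x = o
  · subst hxo
    obtain ⟨c, d, hcd, hc, hd⟩ := hoc
    exact key c d hcd (Or.inl hc) (Or.inl hd)
  by_cases hxi : x = i
  · subst hxi
    obtain ⟨c, d, hcd, hc, hd⟩ := hic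
    exact key c d hcd (Or.inr hc) (Or.inr hd)
  obtain ⟨c, -, hc⟩ := exists_le_covBy_of_lt (lt_of_le_of_ne (ho x) (Ne.symm hxo))
  obtain ⟨d, hd, -⟩ := exists_covBy_le_of_lt (lt_of_le_of_ne (hi x) hxi)
  exact key c d (hc.lt.trans hd.lt).ne (Or.inr hc) (Or.inl hd)

theorem not_isPendant_of_reflTransGen {L : Type*} [Lattice L] [Finite L] (hL : IsBlock L)
    {S : Set L} (h : Relation.ReflTransGen RetractStep Set.univ S) (x : S) : ¬ IsPendant x := by
  have : Finite Lᵒᵈ := ‹Finite L›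
  obtain ⟨⟨o, ho, ho'⟩, i, hi, hi'⟩ := hL
  obtain ⟨o', -, h1, h2⟩ := (hasForkedBot_univ ho ho').reflTransGen h
  have h' : Relation.ReflTransGen RetractStep Set.univ (OrderDual.ofDual ⁻¹' S) :=
    h.lift (fun S : Set L => OrderDual.ofDual ⁻¹' S) fun _ _ h => h.dual
  obtain ⟨i', -, h3, c, d, hcd, hc, hd⟩ := (hasForkedBot_univ hi.toDual hi').reflTransGen h'
  let e := (dualSubsetIso S).symm
  exact not_isPendant_of_forked h1 (i := OrderDual.ofDual (e i')) (fun x => h3 ⟨x.1, x.2⟩) h2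
    ⟨OrderDual.ofDual (e c), OrderDual.ofDual (e d), fun h => hcd (e.injective h),
      CovBy.ofDual ((apply_covBy_apply_iff e).mpr hc),
      CovBy.ofDual ((apply_covBy_apply_iff e).mpr hd)⟩ x

theorem exists_embedding_of_isAssociatedBasicBlock {L : Type*} [Lattice L] [Finite L]
    (hL : IsBlock L) (h : IsAssociatedBasicBlock BasicBlockOne L) :
    ∃ f : L ↪o Ladder, IsGood (Set.range f) := by
  obtain ⟨S, T, hS, -, hT, -, ⟨e⟩⟩ := h
  -- The pendant phase is vacuous for a block: its first step would need a pendant vertex.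
  obtain rfl : T = S := by
    rcases hT.cases_head with h | ⟨_, ⟨x, hx, -⟩, -⟩
    · exact h.symm
    · exact absurd hx (not_isPendant_of_reflTransGen hL hS x)
  obtain ⟨g, hg⟩ := exists_embedding_of_reflTransGen hS
    ⟨e.symm.toOrderEmbedding.trans basicBlockOneEmbedding, by
      convert isGood_range_basicBlockOneEmbedding using 1
      exact e.symm.surjective.range_comp basicBlockOneEmbedding⟩
  refine ⟨(OrderIso.Set.univ (α := L)).symm.toOrderEmbedding.trans g, ?_⟩
  convert hg using 1
  exact (OrderIso.Set.univ (α := L)).symm.surjective.range_comp g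

end Ladder

namespace Ladder

/-! ### Fibres -/

/-- The positions on the edge `e` of the points of `A`. -/
def fib (A : Set Ladder) (e : Fin 6) : Set ℚ := {q | pt e q ∈ A}

@[simp] theorem mem_fib {A : Set Ladder} {e : Fin 6} {q : ℚ} : q ∈ fib A e ↔ pt e q ∈ A := Iff.rfl

theorem finite_fib {A : Set Ladder} (hA : A.Finite) (e : Fin 6) : (fib A e).Finite :=
  hA.preimage fun _ _ _ _ h => (pt.inj h).2

theorem IsGood.ncard_fib_pos {A : Set Ladder} (hA : IsGood A) {e : Fin 6} (he : 3 ≤ e) :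
    0 < (fib A e).ncard :=
  (Set.ncard_pos (finite_fib hA.finite e)).mpr (hA.exists_pt e he)

/-- A set that contains the nodes is the disjoint union of the nodes and the fibres. -/
def equivSum {A : Set Ladder} (hA : ∀ i, node i ∈ A) : A ≃ Fin 4 ⊕ Σ e, fib A e where
  toFun
    | ⟨node i, _⟩ => Sum.inl i
    | ⟨pt e q, h⟩ => Sum.inr ⟨e, q, h⟩
  invFun
    | Sum.inl i => ⟨node i, hA i⟩
    | Sum.inr ⟨e, q⟩ => ⟨pt e q, q.2⟩
  left_inv x := by rcases x with ⟨_ | _, _⟩ <;> rfl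
  right_inv x := by rcases x with _ | ⟨_, _⟩ <;> rfl

theorem card_eq_of_isGood {A : Set Ladder} (hA : IsGood A) :
    Nat.card A = 4 + ∑ e, (fib A e).ncard := by
  have := fun e => (finite_fib hA.finite e).to_subtype
  rw [Nat.card_congr (equivSum hA.node_mem), Nat.card_sum, Nat.card_fin, Nat.card_sigma]
  rfl

theorem nonempty_orderIso_of_ncard_eq {s t : Set ℚ} (hs : s.Finite) (ht : t.Finite)
    (h : s.ncard = t.ncard) : Nonempty (s ≃o t) := by
  have := hs.fintype
  have := ht.fintype
  rw [Set.ncard_eq_toFinset_card', Set.toFinset_card] at h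
  rw [Set.ncard_eq_toFinset_card', Set.toFinset_card] at h
  exact ⟨(Fintype.orderIsoFinOfCardEq s h).symm.trans (Fintype.orderIsoFinOfCardEq t rfl)⟩

/-- Points on different edges compare according to their edges alone, so isomorphisms of the fibres,
which are finite chains of equal size, glue together. -/
theorem nonempty_orderIso_of_ncard_fib_eq {A B : Set Ladder} (hA : IsGood A) (hB : IsGood B)
    (h : ∀ e, (fib A e).ncard = (fib B e).ncard) : Nonempty (A ≃o B) := by
  have φ := fun e => Classical.choice
    (nonempty_orderIso_of_ncard_eq (finite_fib hA.finite e) (finite_fib hB.finite e) (h e))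
  let g : A ≃ B := (equivSum hA.node_mem).trans
    ((Equiv.sumCongr (Equiv.refl _) (Equiv.sigmaCongrRight fun e => (φ e).toEquiv)).trans
      (equivSum hB.node_mem).symm)
  refine ⟨⟨g, ?_⟩⟩
  intro x y
  rcases x with ⟨i | ⟨e, p⟩, hx⟩
  all_goals rcases y with ⟨k | ⟨f, q⟩, hy⟩
  · exact Iff.rfl
  · exact Iff.rfl
  · exact Iff.rfl
  · change pt e (φ e ⟨p, hx⟩) ≤ pt f (φ f ⟨q, hy⟩) ↔ pt e p ≤ pt f q
    by_cases hef : e = f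
    · subst hef
      rw [pt_le_pt_self, pt_le_pt_self, Subtype.coe_le_coe, (φ e).le_iff_le]
      exact Iff.rfl
    · rw [pt_le_pt_of_ne hef, pt_le_pt_of_ne hef]

/-! ### Retraction to the basic block -/

/-- The next occupied position below on the edge serves or, if there is none, the source, since
everything off the edge and below `pt e q` is below the source. -/
theorem exists_pred {A : Set Ladder} (hA : IsGood A) {e : Fin 6} {q : ℚ} :
    ∃ y ∈ A, y < pt e q ∧ (∀ w ∈ A, w < pt e q → w ≤ y) ∧
      ((y = node (edgeSrc e) ∧ ∀ r ∈ fib A e, q ≤ r) ∨ ∃ r, y = pt e r) := by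
  by_cases h : ∃ r ∈ fib A e, r < q
  · obtain ⟨r, ⟨hr, hrq⟩, hmax⟩ := Set.exists_max_image {r ∈ fib A e | r < q} id
      ((finite_fib hA.finite e).subset fun _ h => h.1) h
    refine ⟨pt e r, hr, by simpa, fun w hw hwq => ?_, Or.inr ⟨r, rfl⟩⟩
    rcases w with i | ⟨f, s⟩
    · simpa using hwq
    · by_cases hfe : f = e
      · subst hfe
        simpa using hmax s ⟨hw, by simpa using hwq⟩
      · have := hwq.le
        rwa [pt_le_pt_of_ne hfe] at this ⊢
  · push Not at h
    refine ⟨node (edgeSrc e), hA.node_mem _, by simp, fun w hw hwq => ?_, Or.inl ⟨rfl, h⟩⟩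
    rcases w with i | ⟨f, s⟩
    · simpa using hwq
    · by_cases hfe : f = e
      · subst hfe
        exact absurd (h s hw) (not_le.mpr (by simpa using hwq))
      · have := hwq.le
        rwa [pt_le_pt_of_ne hfe] at this

theorem exists_succ {A : Set Ladder} (hA : IsGood A) {e : Fin 6} {q : ℚ} :
    ∃ z ∈ A, pt e q < z ∧ (∀ w ∈ A, pt e q < w → z ≤ w) ∧
      ((z = node (edgeTgt e) ∧ ∀ r ∈ fib A e, r ≤ q) ∨ ∃ r, z = pt e r) := by
  by_cases h : ∃ r ∈ fib A e, q < r
  · obtain ⟨r, ⟨hr, hrq⟩, hmin⟩ := Set.exists_min_image {r ∈ fib A e | q < r} id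
      ((finite_fib hA.finite e).subset fun _ h => h.1) h
    refine ⟨pt e r, hr, by simpa, fun w hw hwq => ?_, Or.inr ⟨r, rfl⟩⟩
    rcases w with i | ⟨f, s⟩
    · simpa using hwq
    · by_cases hfe : e = f
      · subst hfe
        simpa using hmin s ⟨hw, by simpa using hwq⟩
      · have := hwq.le
        rwa [pt_le_pt_of_ne hfe] at this ⊢
  · push Not at h
    refine ⟨node (edgeTgt e), hA.node_mem _, by simp, fun w hw hwq => ?_, Or.inl ⟨rfl, h⟩⟩
    rcases w with i | ⟨f, s⟩
    · simpa using hwq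
    · by_cases hfe : e = f
      · subst hfe
        exact absurd (h s hw) (not_le.mpr (by simpa using hwq))
      · have := hwq.le
        rwa [pt_le_pt_of_ne hfe] at this

theorem node_eq_of_between : ∀ {e : Fin 6} {k : Fin 4}, e < 3 → edgeSrc e ≤ k → k ≤ edgeTgt e →
    k = edgeSrc e ∨ k = edgeTgt e := by decide

/-- If one neighbour of the point lies on the same edge, then anything off the edge that compares
with that neighbour from the side of the point compares with the point too. If both neighbours are
ends of the edge, it is one of the first three, and nothing lies beside those. -/
theorem isRemovable_pt {A : Set Ladder} (hA : IsGood A) {e : Fin 6} {q : ℚ} (hq : pt e q ∈ A)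
    (h : e < 3 ∨ ∃ r ∈ fib A e, r ≠ q) : IsRemovable (⟨pt e q, hq⟩ : A) := by
  obtain ⟨y, hyA, hyx, hy, hy'⟩ := exists_pred hA (e := e) (q := q)
  obtain ⟨z, hzA, hxz, hz, hz'⟩ := exists_succ hA (e := e) (q := q)
  refine ⟨⟨y, hyA⟩, ⟨z, hzA⟩, ⟨hyx, fun w hw hwx => hw.not_ge (hy w w.2 hwx)⟩,
    ⟨hxz, fun w hw hwz => hwz.not_ge (hz w w.2 hw)⟩,
    fun w hw => (hw.eq_or_eq (hy w w.2 hw.lt) hyx.le).elim Eq.symm fun h => absurd (congrArg Subtype.val h) hyx.ne,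
    fun w hw => (hw.eq_or_eq hxz.le (hz w w.2 hw.lt)).elim (fun h => absurd (congrArg Subtype.val h) hxz.ne') Eq.symm,
    ?_⟩
  rintro ⟨w, hw⟩ hyw hwz
  simp only [Subtype.mk_le_mk, Subtype.mk.injEq] at hyw hwz ⊢
  suffices hc : w ≤ pt e q ∨ pt e q ≤ w by
    rcases hc with hc | hc <;> rcases hc.eq_or_lt with rfl | hc
    · exact Or.inr (Or.inl rfl)
    · exact Or.inl (le_antisymm (hy w hw hc) hyw)
    · exact Or.inr (Or.inl rfl)
    · exact Or.inr (Or.inr (le_antisymm hwz (hz w hw hc)))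
  by_cases hwe : ∃ s, w = pt e s
  · obtain ⟨s, rfl⟩ := hwe
    simpa using le_total s q
  rcases hy' with ⟨rfl, hy'⟩ | ⟨r, rfl⟩
  · rcases hz' with ⟨rfl, hz'⟩ | ⟨r, rfl⟩
    · have he : e < 3 := h.resolve_right fun ⟨r, hr, hrq⟩ =>
        hrq (le_antisymm (hz' r hr) (hy' r hr))
      rcases w with k | ⟨f, r⟩
      · exact (node_eq_of_between he hyw hwz).imp (fun h => by simp [h]) fun h => by simp [h]
      · obtain rfl := edge_eq_of_le he hyw hwz
        simpa using le_total r q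
    · left
      rcases w with k | ⟨f, s⟩
      · exact hwz
      · have hfe : f ≠ e := fun h => hwe ⟨s, h ▸ rfl⟩
        rwa [pt_le_pt_of_ne hfe] at hwz ⊢
  · right
    rcases w with k | ⟨f, s⟩
    · exact hyw
    · have hfe : e ≠ f := fun h => hwe ⟨s, h ▸ rfl⟩
      rwa [pt_le_pt_of_ne hfe] at hyw ⊢

theorem IsGood.diff {A : Set Ladder} (hA : IsGood A) {e : Fin 6} {q : ℚ}
    (h : e < 3 ∨ ∃ r ∈ fib A e, r ≠ q) : IsGood (A \ {pt e q}) := by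
  refine ⟨hA.finite.subset Set.sdiff_subset, fun i => ⟨hA.node_mem i, by simp⟩, fun f hf => ?_⟩
  obtain ⟨p, hp⟩ := hA.exists_pt f hf
  by_cases hef : e = f
  · subst hef
    obtain ⟨r, hr, hrq⟩ := h.resolve_left hf.not_gt
    exact ⟨r, hr, by simpa⟩
  · exact ⟨p, hp, fun h => hef (by simpa using (pt.inj h).1.symm)⟩

/-- The number of points on each edge in the basic block. -/
def baseCount (e : Fin 6) : ℕ := if e < 3 then 0 else 1

theorem exists_retract {A : Set Ladder} (hA : IsGood A) :
    ∃ B, IsGood B ∧ (∀ e, (fib B e).ncard = baseCount e) ∧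
      Relation.ReflTransGen RetractStep A B := by
  induction hn : A.ncard using Nat.strong_induction_on generalizing A with
  | _ n ih =>
  by_cases h : ∃ e q, pt e q ∈ A ∧ (e < 3 ∨ ∃ r ∈ fib A e, r ≠ q)
  · obtain ⟨e, q, hq, h⟩ := h
    have := hA.finite.to_subtype
    have hstep : RetractStep A (A \ {pt e q}) :=
      retractStep_iff.mpr ⟨⟨pt e q, hq⟩, isRemovable_pt hA hq h, rfl⟩
    obtain ⟨B, hB, hB', hAB⟩ := ih _ (hn ▸ Set.ncard_sdiff_singleton_lt_of_mem hq hA.finite)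
      (hA.diff h) rfl
    exact ⟨B, hB, hB', hAB.head hstep⟩
  · push Not at h
    refine ⟨A, hA, fun e => ?_, .refl⟩
    by_cases he : e < 3
    · rw [baseCount, if_pos he, Set.ncard_eq_zero (finite_fib hA.finite e)]
      ext q
      simp only [mem_fib, Set.mem_empty_iff_false, iff_false]
      exact fun hq => (h e q hq).1.not_gt he
    · rw [baseCount, if_neg he, Set.ncard_eq_one]
      obtain ⟨q, hq⟩ := hA.exists_pt e (not_lt.mp he)
      exact ⟨q, Set.eq_singleton_iff_unique_mem.mpr ⟨hq, (h e q hq).2⟩⟩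

theorem exists_between_edge : ∀ {e : Fin 6}, 3 ≤ e → ∃ m, edgeSrc e < m ∧ m < edgeTgt e := by
  decide

/-- A node lacks a lower or an upper cover, or has several. A sole point on one of the last three
edges has a node beside it strictly between the ends of the edge. -/
theorem isBasicRetract_of_ncard_fib {A : Set Ladder} (hA : IsGood A)
    (h : ∀ e, (fib A e).ncard = baseCount e) : IsBasicRetract A := by
  have := hA.finite.to_subtype
  rw [isBasicRetract_iff]
  rintro ⟨x, hxA⟩ ⟨⟨y, hyA⟩, ⟨z, hzA⟩, hyx, hxz, hy, hz, hI⟩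
  have hy' : ∀ w ∈ A, w < x → w ≤ y := fun w hw hwx => by
    obtain ⟨c, hwc, hc⟩ := exists_le_covBy_of_lt (show (⟨w, hw⟩ : A) < ⟨x, hxA⟩ from hwx)
    obtain rfl := hy c hc
    exact hwc
  have hz' : ∀ w ∈ A, x < w → z ≤ w := fun w hw hwx => by
    obtain ⟨c, hwc, hc⟩ := exists_covBy_le_of_lt (show (⟨x, hxA⟩ : A) < ⟨w, hw⟩ from hwx)
    obtain rfl := hz c hwc
    exact hc
  have hyx' : y < x := hyx.lt
  have hxz' : x < z := hxz.lt
  rcases x with i | ⟨e, q⟩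
  · obtain ⟨p, hp⟩ := hA.exists_pt 3 (by decide)
    obtain ⟨p', hp'⟩ := hA.exists_pt 4 (by decide)
    fin_cases i
    · exact hyx'.not_ge (node_zero_le y)
    -- A unique upper cover `z` of node 1 would be below both node 2 and a point of edge 3, whose
    -- meet is node 1 itself.
    · exact hxz'.not_ge ((le_inf (hz' _ hp (by simp [edgeSrc]))
        (hz' _ (hA.node_mem 2) (by simp))).trans_eq (by rfl))
    · exact hyx'.not_ge (Eq.trans_le (by rfl) (sup_le (hy' _ hp' (by simp [edgeTgt]))
        (hy' _ (hA.node_mem 1) (by simp))))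
    · exact hxz'.not_ge (le_node_three z)
  · have he : 3 ≤ e := by
      by_contra! he
      have h0 := h e
      rw [baseCount, if_pos he, Set.ncard_eq_zero (finite_fib hA.finite e)] at h0
      exact (h0 ▸ hxA : q ∈ (∅ : Set ℚ))
    have h1 : ∀ r ∈ fib A e, r = q := by
      have h0 := h e
      rw [baseCount, if_neg he.not_gt, Set.ncard_eq_one] at h0
      obtain ⟨r, hr⟩ := h0
      intro s hs
      have hq : q ∈ fib A e := hxA
      rw [hr] at hs hq
      exact hs.trans hq.symm
    obtain ⟨m, hm1, hm2⟩ := exists_between_edge he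
    have hym : y ≤ node m := by
      rcases y with k | ⟨f, r⟩
      · exact (node_lt_pt.mp hyx').trans hm1.le
      · by_cases hfe : f = e
        · subst hfe
          exact absurd (h1 r hyA) (by simpa using hyx'.ne)
        · exact ((pt_le_pt_of_ne hfe).mp hyx'.le).trans hm1.le
    have hmz : node m ≤ z := by
      rcases z with k | ⟨f, r⟩
      · exact hm2.le.trans (pt_lt_node.mp hxz')
      · by_cases hfe : e = f
        · subst hfe
          exact absurd (h1 r hzA) (by simpa using hxz'.ne')
        · exact hm2.le.trans ((pt_le_pt_of_ne hfe).mp hxz'.le)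
    rcases hI ⟨node m, hA.node_mem m⟩ hym hmz with h2 | h2 | h2
    · obtain rfl : node m = y := congrArg Subtype.val h2
      exact hm1.not_ge (node_lt_pt.mp hyx')
    · simp at h2
    · obtain rfl : node m = z := congrArg Subtype.val h2
      exact hm2.not_ge (pt_lt_node.mp hxz')

theorem ncard_fib_range_basicBlockOneEmbedding (e : Fin 6) :
    (fib (Set.range basicBlockOneEmbedding) e).ncard = baseCount e := by
  have h0 : ∀ q, pt e q ∈ Set.range basicBlockOneEmbedding → 3 ≤ e ∧ q = 0 := by
    rintro q ⟨((i | i) | i) | i, h⟩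
    · exact absurd h (by simp [basicBlockOneEmbedding, ofBasicBlockOne])
    all_goals
      obtain ⟨rfl, rfl⟩ := pt.inj h
      exact ⟨by decide, rfl⟩
  by_cases he : e < 3
  · rw [baseCount, if_pos he, Set.ncard_eq_zero
      (finite_fib isGood_range_basicBlockOneEmbedding.finite e)]
    ext q
    simp only [Set.mem_empty_iff_false, iff_false]
    exact fun hq => (h0 q hq).1.not_gt he
  · rw [baseCount, if_neg he, Set.ncard_eq_one]
    refine ⟨0, Set.eq_singleton_iff_unique_mem.mpr ⟨?_, fun q hq => (h0 q hq).2⟩⟩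
    obtain ⟨q, hq⟩ := isGood_range_basicBlockOneEmbedding.exists_pt e (not_lt.mp he)
    exact (h0 q hq).2 ▸ hq

/-- The image is retracted inside `Ladder` to one point on each of the last three edges. By the
fibre sizes the result is a copy of `B₁`. -/
theorem isAssociatedBasicBlock_of_isGood {L : Type*} [Lattice L] (f : L ↪o Ladder)
    (hf : IsGood (Set.range f)) : IsAssociatedBasicBlock BasicBlockOne L := by
  have : Finite L := (Set.finite_range_iff f.injective).mp hf.finite
  obtain ⟨B, hB, hB', hAB⟩ := exists_retract hf
  have hfB := reflTransGen_retractStep_preimage f subset_rfl hAB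
  rw [Set.preimage_range] at hfB
  let g : ↥(f ⁻¹' B) ≃o B := f.preimageIso hfB.1
  have := hB.finite.to_subtype
  obtain ⟨φ⟩ := nonempty_orderIso_of_ncard_fib_eq isGood_range_basicBlockOneEmbedding hB
    fun e => (ncard_fib_range_basicBlockOneEmbedding e).trans (hB' e).symm
  exact ⟨f ⁻¹' B, f ⁻¹' B, hfB.2, (isBasicRetract_of_ncard_fib hB hB').map g.symm, .refl,
    not_isPendant_of_reflTransGen (isBlock_of_isGood f hf) hfB.2,
    ⟨basicBlockOneEmbedding.orderIso.trans (φ.trans g.symm)⟩⟩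

end Ladder

/-! ### Nullity -/

theorem card_edgeSet_hasse (P : Type*) [PartialOrder P] :
    Nat.card (SimpleGraph.hasse P).edgeSet = Nat.card {p : P × P // p.1 ⋖ p.2} := by
  refine (Nat.card_congr (Equiv.ofBijective
    (fun p => ⟨s(p.1.1, p.1.2), Or.inl p.2⟩) ⟨?_, ?_⟩)).symm
  · rintro ⟨⟨x, y⟩, h⟩ ⟨⟨x', y'⟩, h'⟩ heq
    rcases Sym2.eq_iff.mp (congrArg Subtype.val heq) with ⟨h1, h2⟩ | ⟨h1, h2⟩
    · exact Subtype.ext (Prod.ext h1 h2)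
    · simp only at h1 h2 h h'
      subst h1 h2
      exact absurd h.lt h'.lt.not_gt
  · rintro ⟨e, he⟩
    induction e with
    | _ x y =>
      rcases (he : x ⋖ y ∨ y ⋖ x) with h | h
      · exact ⟨⟨(x, y), h⟩, rfl⟩
      · exact ⟨⟨(y, x), h⟩, Subtype.ext Sym2.eq_swap⟩

theorem card_connectedComponent_hasse {P : Type*} [PartialOrder P] [Finite P] {o : P}
    (ho : ∀ x, o ≤ x) : Nat.card (SimpleGraph.hasse P).ConnectedComponent = 1 := by
  classical
  have := Fintype.ofFinite P
  let _ : LocallyFiniteOrder P := Fintype.toLocallyFiniteOrder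
  have hr : ∀ x, (SimpleGraph.hasse P).Reachable o x := fun x => by
    have h := le_iff_reflTransGen_covBy.mp (ho x)
    induction h with
    | refl => exact SimpleGraph.Reachable.refl _
    | tail _ h ih => exact ih.trans (SimpleGraph.Adj.reachable (Or.inl h))
  have hp : (SimpleGraph.hasse P).Preconnected := fun x y => (hr x).symm.trans (hr y)
  exact Nat.card_eq_one_iff_unique.mpr
    ⟨hp.subsingleton_connectedComponent, ⟨(SimpleGraph.hasse P).connectedComponentMk o⟩⟩

/-- The cover graphs of isomorphic posets are isomorphic. -/
def OrderIso.hasseIso {P Q : Type*} [PartialOrder P] [PartialOrder Q] (e : P ≃o Q) :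
    SimpleGraph.hasse P ≃g SimpleGraph.hasse Q where
  toEquiv := e.toEquiv
  map_rel_iff' := or_congr (apply_covBy_apply_iff e) (apply_covBy_apply_iff e)

theorem nullity_congr {P Q : Type*} [PartialOrder P] [PartialOrder Q] (e : P ≃o Q) :
    nullity P = nullity Q := by
  rw [nullity, nullity, Nat.card_congr e.hasseIso.mapEdgeSet,
    Nat.card_congr e.hasseIso.connectedComponentEquiv, Nat.card_congr e.toEquiv]

theorem CovBy.eq_of_le_or_le {P : Type*} [PartialOrder P] {x y z : P} (hy : x ⋖ y) (hz : x ⋖ z)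
    (h : y ≤ z ∨ z ≤ y) : y = z := by
  rcases h with h | h
  · exact (hz.eq_or_eq hy.le h).resolve_left hy.ne'
  · exact ((hy.eq_or_eq hz.le h).resolve_left hz.ne').symm

namespace Ladder

/-- The lower end of a piece of an edge: the source of the edge, or a point on it. -/
def pieceBot {A : Set Ladder} : Fin 6 ⊕ (Σ e, fib A e) → Ladder
  | .inl e => node (edgeSrc e)
  | .inr q => pt q.1 q.2

/-- The edge of a piece. -/
def pieceEdge {A : Set Ladder} : Fin 6 ⊕ (Σ e, fib A e) → Fin 6
  | .inl e => e
  | .inr q => q.1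

/-- `y` is on the edge `e`, and is not its source. -/
def IsAbove (e : Fin 6) (y : Ladder) : Prop := y = node (edgeTgt e) ∨ ∃ r, y = pt e r

theorem IsAbove.le_or_le {e : Fin 6} {y z : Ladder} (hy : IsAbove e y) (hz : IsAbove e z) :
    y ≤ z ∨ z ≤ y := by
  rcases hy with rfl | ⟨r, rfl⟩ <;> rcases hz with rfl | ⟨s, rfl⟩ <;> simp [le_total]

/-- The occupied positions cut each edge into pieces, one starting at its source and one at each
position; each piece is a single covering. The source of an empty edge is covered by its target
because only the first three edges can be empty. -/
theorem exists_cover_piece {A : Set Ladder} (hA : IsGood A) (w : Fin 6 ⊕ (Σ e, fib A e)) :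
    ∃ p : {p : A × A // p.1 ⋖ p.2}, p.1.1.1 = pieceBot w ∧ IsAbove (pieceEdge w) p.1.2.1 := by
  rcases w with e | ⟨e, q, hq⟩
  · by_cases h : (fib A e).Nonempty
    · obtain ⟨p, hp, hmin⟩ := Set.exists_min_image _ id (finite_fib hA.finite e) h
      refine ⟨⟨(⟨node (edgeSrc e), hA.node_mem _⟩, ⟨pt e p, hp⟩),
        ⟨node_lt_pt.mpr le_rfl, ?_⟩⟩, rfl, Or.inr ⟨p, rfl⟩⟩
      rintro ⟨k | ⟨f, r⟩, hw⟩ h1 h2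
      · exact (node_lt_node.mp h1).not_ge (node_lt_pt.mp h2)
      · by_cases hfe : f = e
        · subst hfe
          exact (pt_lt_pt_self.mp h2).not_ge (hmin r hw)
        · exact (((node_lt_pt.mp h1).trans_lt (edgeSrc_lt_edgeTgt f)).trans_le
            ((pt_le_pt_of_ne hfe).mp h2.le)).false
    · have he : e < 3 := by
        by_contra! he
        exact h (hA.exists_pt e he)
      refine ⟨⟨(⟨node (edgeSrc e), hA.node_mem _⟩, ⟨node (edgeTgt e), hA.node_mem _⟩),
        ⟨node_lt_node.mpr (edgeSrc_lt_edgeTgt e), ?_⟩⟩, rfl, Or.inl rfl⟩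
      rintro ⟨k | ⟨f, r⟩, hw⟩ h1 h2
      · have h1' := node_lt_node.mp h1
        have h2' := node_lt_node.mp h2
        exact (node_eq_of_between he h1'.le h2'.le).elim h1'.ne' h2'.ne
      · obtain rfl := edge_eq_of_le he (node_lt_pt.mp h1) (pt_lt_node.mp h2)
        exact h ⟨r, hw⟩
  · obtain ⟨z, hzA, hxz, hz, hz'⟩ := exists_succ hA (e := e) (q := q)
    exact ⟨⟨(⟨pt e q, hq⟩, ⟨z, hzA⟩), ⟨hxz, fun w hw hwz => hwz.not_ge (hz w w.2 hw)⟩⟩, rfl,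
      hz'.imp And.left id⟩

theorem edge_eq_or_exists_between : ∀ {e f : Fin 6}, edgeSrc e = edgeSrc f →
    edgeTgt e = edgeTgt f → e = f ∨ ∃ m, edgeSrc e < m ∧ m < edgeTgt e := by decide

theorem exists_piece_of_cover {A : Set Ladder} (hA : IsGood A) {x y : Ladder} (hx : x ∈ A)
    (hy : y ∈ A) (h : (⟨x, hx⟩ : A) ⋖ ⟨y, hy⟩) :
    ∃ w : Fin 6 ⊕ (Σ e, fib A e), pieceBot w = x ∧ IsAbove (pieceEdge w) y := by
  have hnode : ∀ k, ¬ (x < node k ∧ node k < y) := fun k hk =>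
    h.2 (c := ⟨node k, hA.node_mem k⟩) hk.1 hk.2
  have hxy : x < y := h.lt
  rcases x with i | ⟨e, q⟩ <;> rcases y with k | ⟨f, r⟩
  · obtain ⟨e, -, h1, h2⟩ := exists_edge_of_succ (node_lt_node.mp hxy) fun l h1 h2 => by
      by_contra! h3
      exact hnode l ⟨node_lt_node.mpr (lt_of_le_of_ne h1 h3.1.symm),
        node_lt_node.mpr (lt_of_le_of_ne h2 h3.2)⟩
    exact ⟨.inl e, congrArg node h1, Or.inl (congrArg node h2.symm)⟩
  · refine ⟨.inl f, congrArg node (le_antisymm ?_ (node_lt_pt.mp hxy)), Or.inr ⟨r, rfl⟩⟩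
    by_contra! hlt
    exact hnode _ ⟨node_lt_node.mpr hlt, node_lt_pt.mpr le_rfl⟩
  · refine ⟨.inr ⟨e, q, hx⟩, rfl, Or.inl (congrArg node (le_antisymm ?_ (pt_lt_node.mp hxy)))⟩
    by_contra! hlt
    exact hnode _ ⟨pt_lt_node.mpr le_rfl, node_lt_node.mpr hlt⟩
  · refine ⟨.inr ⟨e, q, hx⟩, rfl, Or.inr ⟨r, ?_⟩⟩
    by_contra hef
    have hef' : e ≠ f := fun h => hef (h ▸ rfl)
    exact hnode (edgeTgt e) ⟨pt_lt_node.mpr le_rfl,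
      node_lt_pt.mpr ((pt_le_pt_of_ne hef').mp hxy.le)⟩

/-- Pieces biject with coverings. Six start at a source and one at each of the remaining `|A| - 4`
elements, which makes `|A| + 2`. -/
theorem card_covers {A : Set Ladder} (hA : IsGood A) :
    Nat.card {p : A × A // p.1 ⋖ p.2} = Nat.card A + 2 := by
  have := fun e => (finite_fib hA.finite e).to_subtype
  choose G hG1 hG2 using exists_cover_piece hA
  have hG : Function.Bijective G := by
    constructor
    · intro w w' h
      have h1 : pieceBot w = pieceBot w' := by rw [← hG1, ← hG1, h]
      have h2 := hG2 w
      have h3 := hG2 w'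
      have h4 := hG1 w
      rw [← h] at h3
      generalize G w = p at h2 h3 h4
      obtain ⟨⟨⟨x, hx⟩, ⟨y, hy⟩⟩, hxy⟩ := p
      simp only at h2 h3 h4
      rcases w with e | ⟨e, q, hq⟩ <;> rcases w' with f | ⟨f, r, hr⟩
      · have h5 : edgeSrc e = edgeSrc f := node.inj h1
        rcases h2 with rfl | ⟨r, rfl⟩ <;> rcases h3 with h3 | ⟨s, h3⟩
        -- Distinct edges with the same ends have a node strictly between these, so a covering of
        -- nodes determines its edge.
        · rcases edge_eq_or_exists_between h5 (node.inj h3) with rfl | ⟨m, hm1, hm2⟩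
          · rfl
          · subst h4
            exact absurd (node_lt_node.mpr hm2)
              (hxy.2 (c := ⟨node m, hA.node_mem m⟩) (node_lt_node.mpr hm1))
        · cases h3
        · cases h3
        · obtain rfl : e = f := (pt.inj h3).1
          rfl
      · cases h1
      · cases h1
      · obtain ⟨h5, h6⟩ := pt.inj h1
        simp only at h5 h6
        subst h5 h6
        rfl
    · rintro ⟨⟨⟨x, hx⟩, ⟨y, hy⟩⟩, hxy⟩
      obtain ⟨w, hw, hwy⟩ := exists_piece_of_cover hA hx hy hxy
      refine ⟨w, ?_⟩
      have h2 := hG2 w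
      have h4 := hG1 w
      generalize G w = p at h2 h4
      obtain ⟨⟨⟨x', hx'⟩, ⟨y', hy'⟩⟩, hxy'⟩ := p
      simp only at h2 h4
      rw [hw] at h4
      subst h4
      -- Two upper covers of one element along the same edge are comparable, hence equal.
      exact Subtype.ext (Prod.ext rfl (hxy'.eq_of_le_or_le hxy (h2.le_or_le hwy)))
  rw [← Nat.card_congr (Equiv.ofBijective G hG), Nat.card_sum, Nat.card_fin, Nat.card_sigma,
    card_eq_of_isGood hA]
  simp only [Nat.card_coe_set_eq]
  omega

theorem nullity_of_isGood {A : Set Ladder} (hA : IsGood A) : nullity A = 3 := by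
  have := hA.finite.to_subtype
  rw [nullity, card_edgeSet_hasse, card_covers hA,
    card_connectedComponent_hasse (o := (⟨node 0, hA.node_mem 0⟩ : A)) fun x => node_zero_le x.1]
  push_cast
  ring

/-- The block property and the associated basic block already yield the embedding; the number and
comparability of the reducible elements and the nullity are then consequences. -/
theorem isBlockWith_iff {L : Type} [Lattice L] [Finite L] :
    IsBlockWith BasicBlockOne 4 3 L ↔ ∃ f : L ↪o Ladder, IsGood (Set.range f) := by
  constructor
  · rintro ⟨h1, -, -, -, h2⟩
    exact exists_embedding_of_isAssociatedBasicBlock h1 h2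
  · rintro ⟨f, hf⟩
    exact ⟨isBlock_of_isGood f hf, ncard_redSet_of_isGood f hf, isChain_redSet_of_isGood f hf,
      (nullity_congr f.orderIso).trans (nullity_of_isGood hf), isAssociatedBasicBlock_of_isGood f hf⟩

end Ladder

namespace Ladder

/-! ### Adjunct representations -/

theorem le_pt_iff_of_ne {w : Ladder} {e : Fin 6} (hw : ∀ q, w ≠ pt e q) {q : ℚ} :
    w ≤ pt e q ↔ w ≤ node (edgeSrc e) := by
  rcases w with i | ⟨f, r⟩
  · rfl
  · exact pt_le_pt_of_ne fun h => hw r (h ▸ rfl)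

theorem pt_le_iff_of_ne {w : Ladder} {e : Fin 6} (hw : ∀ q, w ≠ pt e q) {q : ℚ} :
    pt e q ≤ w ↔ node (edgeTgt e) ≤ w := by
  rcases w with i | ⟨f, r⟩
  · rfl
  · exact pt_le_pt_of_ne fun h => hw r (h ▸ rfl)

/-- An embedding into the ladder extends to an adjunct sum with a chain, if the chain is placed on
an unoccupied edge. -/
def adjunctEmbedding {P Q : Type} [PartialOrder P] [PartialOrder Q] {a b : P}
    (h : IsAdjunctPair a b) (e : Fin 6) (φ : P ↪o Ladder) (γ : Q ↪o ℚ)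
    (ha : φ a = node (edgeSrc e)) (hb : φ b = node (edgeTgt e)) (hφ : ∀ x q, φ x ≠ pt e q) :
    Adjunct P Q h ↪o Ladder :=
  OrderEmbedding.ofMapLEIff
    (fun x => match x with
      | .inl x => φ x
      | .inr k => pt e (γ k))
    (by
      rintro (x | x) (y | y)
      · exact φ.le_iff_le
      · exact (le_pt_iff_of_ne (hφ x)).trans (ha ▸ φ.le_iff_le)
      · exact (pt_le_iff_of_ne (hφ y)).trans (hb ▸ φ.le_iff_le)
      · exact pt_le_pt_self.trans γ.le_iff_le)

theorem range_adjunctEmbedding {P Q : Type} [PartialOrder P] [PartialOrder Q] {a b : P}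
    (h : IsAdjunctPair a b) (e : Fin 6) (φ : P ↪o Ladder) (γ : Q ↪o ℚ)
    (ha : φ a = node (edgeSrc e)) (hb : φ b = node (edgeTgt e)) (hφ : ∀ x q, φ x ≠ pt e q) :
    Set.range (adjunctEmbedding h e φ γ ha hb hφ) = Set.range φ ∪ pt e '' Set.range γ := by
  ext w
  constructor
  · rintro ⟨x | x, rfl⟩
    · exact Or.inl ⟨x, rfl⟩
    · exact Or.inr ⟨_, ⟨x, rfl⟩, rfl⟩
  · rintro (⟨x, rfl⟩ | ⟨_, ⟨x, rfl⟩, rfl⟩)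
    · exact ⟨.inl x, rfl⟩
    · exact ⟨.inr x, rfl⟩

theorem exists_orderIso_of_range_eq {P Q R : Type*} [PartialOrder P] [PartialOrder Q]
    [PartialOrder R] (f : P ↪o R) (g : Q ↪o R) (h : Set.range f = Set.range g) :
    ∃ e : P ≃o Q, ∀ x, g (e x) = f x := by
  refine ⟨f.orderIso.trans ((OrderIso.setCongr _ _ h).trans g.orderIso.symm), fun x => ?_⟩
  exact congrArg Subtype.val
    (g.orderIso.apply_symm_apply (OrderIso.setCongr _ _ h (f.orderIso x)))

theorem exists_enum_fib {A : Set Ladder} (hA : IsGood A) {e : Fin 6} (he : 3 ≤ e) :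
    ∃ n, 1 ≤ n ∧ ∃ γ : Fin n ↪o ℚ, Set.range γ = fib A e := by
  have := (finite_fib hA.finite e).fintype
  refine ⟨_, hA.ncard_fib_pos he,
    (Fintype.orderIsoFinOfCardEq (fib A e) ?_).toOrderEmbedding.trans (OrderEmbedding.subtype _),
    ?_⟩
  · rw [Set.ncard_eq_toFinset_card', Set.toFinset_card]
  · ext q
    simp

/-- The nodes of `A` and the points of `A` on the edges `0 → 1`, `1 → 2`, `2 → 3`. -/
def spine (A : Set Ladder) : Set Ladder := {x ∈ A | ∀ e q, x = pt e q → e < 3}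

theorem edge_comparable : ∀ {e f : Fin 6}, e < 3 → f < 3 → e ≠ f →
    edgeTgt e ≤ edgeSrc f ∨ edgeTgt f ≤ edgeSrc e := by decide

theorem node_comparable : ∀ {e : Fin 6} {k : Fin 4}, e < 3 → k ≤ edgeSrc e ∨ edgeTgt e ≤ k := by
  decide

theorem isChain_spine (A : Set Ladder) : IsChain (· ≤ ·) (spine A) := by
  rintro x ⟨-, hx⟩ y ⟨-, hy⟩ -
  change x ≤ y ∨ y ≤ x
  rcases x with i | ⟨e, p⟩ <;> rcases y with k | ⟨f, q⟩
  · exact le_total i k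
  · exact node_comparable (hy _ _ rfl)
  · exact (node_comparable (hx _ _ rfl)).symm
  · by_cases hef : e = f
    · subst hef
      simpa using le_total p q
    · rw [pt_le_pt_of_ne hef, pt_le_pt_of_ne (Ne.symm hef)]
      exact edge_comparable (hx _ _ rfl) (hy _ _ rfl) hef

theorem exists_enum_spine {A : Set Ladder} (hA : IsGood A) :
    ∃ n, ∃ γ : Fin (n + 1) ↪o Ladder, Set.range γ = spine A := by
  classical
  have hfin : (spine A).Finite := hA.finite.subset fun _ h => h.1
  have := hfin.fintype
  let _ : LinearOrder (spine A) := (isChain_spine A).linearOrder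
  have h0 : node 0 ∈ spine A := ⟨hA.node_mem 0, by simp⟩
  obtain ⟨n, hn⟩ := Nat.exists_eq_succ_of_ne_zero
    (Fintype.card_pos_iff.mpr ⟨(⟨node 0, h0⟩ : spine A)⟩).ne'
  refine ⟨n, (Fintype.orderIsoFinOfCardEq (spine A) hn).toOrderEmbedding.trans
    (OrderEmbedding.subtype _), ?_⟩
  ext q
  simp

theorem edge_eq_of_three_le : ∀ {e : Fin 6}, 3 ≤ e → e = 3 ∨ e = 4 ∨ e = 5 := by decide

theorem isAdjunctPair_of_lt_of_lt {P : Type*} [PartialOrder P] {a b c : P} (h1 : a < b)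
    (h2 : b < c) : IsAdjunctPair a c :=
  ⟨h1.trans h2, fun h => h.2 h1 h2⟩

/-- The chain `C₀` is the spine, and the fibres over the edges 3, 4, 5 are adjoined at the ends of
those edges. The resulting sum embeds into `Ladder` with the same range as `L`. -/
theorem hasAdjunctRepresentation {L : Type} [Lattice L] (f : L ↪o Ladder)
    (hf : IsGood (Set.range f)) : HasAdjunctRepresentation L := by
  obtain ⟨n₀, γ₀, hγ₀⟩ := exists_enum_spine hf
  obtain ⟨n₁, hn₁, γ₁, hγ₁⟩ := exists_enum_fib hf (e := 3) (by decide)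
  obtain ⟨n₂, hn₂, γ₂, hγ₂⟩ := exists_enum_fib hf (e := 4) (by decide)
  obtain ⟨n₃, hn₃, γ₃, hγ₃⟩ := exists_enum_fib hf (e := 5) (by decide)
  have hν : ∀ i, ∃ c, γ₀ c = node i := fun i => by
    change node i ∈ Set.range γ₀
    rw [hγ₀]
    exact ⟨hf.node_mem i, by simp⟩
  choose ν hν using hν
  have hlt : ∀ {i k}, i < k → ν i < ν k := fun h => by
    rw [← γ₀.lt_iff_lt, hν, hν]
    exact node_lt_node.mpr h
  have h0 : ν 0 = 0 := le_antisymm (by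
    rw [← γ₀.le_iff_le, hν]
    exact node_zero_le _) (Fin.zero_le _)
  have h3 : ν 3 = Fin.last n₀ := le_antisymm (Fin.le_last _) (by
    rw [← γ₀.le_iff_le, hν]
    exact le_node_three _)
  have hne : ∀ x e q, 3 ≤ e → γ₀ x ≠ pt e q := fun x e q he h => by
    have hx : γ₀ x ∈ spine (Set.range f) := hγ₀ ▸ Set.mem_range_self x
    exact (hx.2 e q h).not_ge he
  have h01 : (0 : Fin (n₀ + 1)) < ν 1 := h0 ▸ hlt (by decide)
  have h12 : ν 1 < ν 2 := hlt (by decide)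
  have h23 : ν 2 < Fin.last n₀ := h3 ▸ hlt (by decide)
  have p₁ : IsAdjunctPair (ν 1) (Fin.last n₀) := isAdjunctPair_of_lt_of_lt h12 h23
  let φ₁ := adjunctEmbedding p₁ 3 γ₀ γ₁ (hν 1) (h3 ▸ hν 3) (fun x q => hne x 3 q (by decide))
  have p₂ : IsAdjunctPair (Adjunct.inl 0 : Adjunct (Fin (n₀ + 1)) (Fin n₁) p₁)
      (Adjunct.inl (ν 2)) := Adjunct.isAdjunctPair_inl h01 h12
  let φ₂ := adjunctEmbedding p₂ 4 φ₁ γ₂ ((congrArg γ₀ h0.symm).trans (hν 0)) (hν 2) (by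
    rintro (x | x) q
    · exact hne x 4 q (by decide)
    · exact fun h => absurd (pt.inj h).1 (by decide))
  have p₃ : IsAdjunctPair (Adjunct.inl (Adjunct.inl 0) : Adjunct _ (Fin n₂) p₂)
      (Adjunct.inl (Adjunct.inl (ν 2))) :=
    Adjunct.isAdjunctPair_inl (Adjunct.inl_lt_inl h01) (Adjunct.inl_lt_inl h12)
  let φ₃ := adjunctEmbedding p₃ 5 φ₂ γ₃ ((congrArg γ₀ h0.symm).trans (hν 0)) (hν 2) (by
    rintro ((x | x) | x) q
    · exact hne x 5 q (by decide)
    · exact fun h => absurd (pt.inj h).1 (by decide)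
    · exact fun h => absurd (pt.inj h).1 (by decide))
  have hrange : Set.range φ₃ = Set.range f := by
    have r₁ : Set.range φ₁ = Set.range γ₀ ∪ pt 3 '' Set.range γ₁ := range_adjunctEmbedding ..
    have r₂ : Set.range φ₂ = Set.range φ₁ ∪ pt 4 '' Set.range γ₂ := range_adjunctEmbedding ..
    have r₃ : Set.range φ₃ = Set.range φ₂ ∪ pt 5 '' Set.range γ₃ := range_adjunctEmbedding ..
    rw [r₃, r₂, r₁, hγ₀, hγ₁, hγ₂, hγ₃]
    ext w
    constructor
    · rintro (((h | ⟨q, hq, rfl⟩) | ⟨q, hq, rfl⟩) | ⟨q, hq, rfl⟩)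
      exacts [h.1, hq, hq, hq]
    · intro hw
      by_cases hs : w ∈ spine (Set.range f)
      · exact Or.inl (Or.inl (Or.inl hs))
      · have : ∃ e q, w = pt e q ∧ 3 ≤ e := by
          by_contra! h
          exact hs ⟨hw, h⟩
        obtain ⟨e, q, rfl, he⟩ := this
        obtain rfl | rfl | rfl := edge_eq_of_three_le he
        · exact Or.inl (Or.inl (Or.inr ⟨q, hw, rfl⟩))
        · exact Or.inl (Or.inr ⟨q, hw, rfl⟩)
        · exact Or.inr ⟨q, hw, rfl⟩
  obtain ⟨ε, hε⟩ := exists_orderIso_of_range_eq φ₃ f hrange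
  have hε₀ : ∀ c, f (ε (.inl (.inl (.inl c)))) = γ₀ c := fun c => hε _
  refine ⟨n₀, n₁, n₂, n₃, ν 1, ν 2, p₁, p₂, p₃, ε, h01, h12, h23, hn₁, hn₂, hn₃, ⟨?_, ?_⟩, ?_⟩
  · rintro _ ⟨c, rfl⟩ _ ⟨d, rfl⟩ -
    change _ ≤ _ ∨ _ ≤ _
    simp only [← f.le_iff_le, hε₀, γ₀.le_iff_le]
    exact le_total c d
  · intro t ht hst
    refine hst.antisymm fun x hx => ?_
    by_cases hs : f x ∈ spine (Set.range f)
    · rw [← hγ₀] at hs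
      obtain ⟨c, hc⟩ := hs
      exact ⟨c, f.injective ((hε₀ c).trans hc)⟩
    · have : ∃ e q, f x = pt e q ∧ 3 ≤ e := by
        by_contra! h
        exact hs ⟨⟨x, rfl⟩, h⟩
      obtain ⟨e, q, hxe, he⟩ := this
      -- Maximality: an element off the spine is incomparable to a node strictly between the ends of
      -- its edge.
      obtain ⟨m, hm1, hm2⟩ := exists_between_edge he
      have hm : f (ε (.inl (.inl (.inl (ν m))))) = node m := (hε₀ _).trans (hν m)
      rcases ht.total hx (hst ⟨ν m, rfl⟩) with h | h <;>
        rw [← f.le_iff_le, hxe, hm] at h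
      · exact absurd h hm2.not_ge
      · exact absurd h hm1.not_ge
  · ext x
    rw [mem_redSet_iff_of_isGood f hf]
    have h4 : ∀ i, f x = node i ↔ ε (.inl (.inl (.inl (ν i)))) = x := fun i => by
      rw [← hν i, ← hε₀, f.injective.eq_iff, eq_comm]
    have h5 : ({0, ν 1, ν 2, Fin.last n₀} : Set (Fin (n₀ + 1))) = {ν 0, ν 1, ν 2, ν 3} := by
      rw [h0, h3]
    rw [h5]
    simp only [h4, Set.image_insert_eq, Set.image_singleton, Set.mem_insert_iff,
      Set.mem_singleton_iff]
    constructor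
    · rintro ⟨i, rfl⟩
      fin_cases i <;> simp
    · rintro (rfl | rfl | rfl | rfl)
      exacts [⟨0, rfl⟩, ⟨1, rfl⟩, ⟨2, rfl⟩, ⟨3, rfl⟩]

end Ladder

namespace Ladder

/-! ### Counting isomorphism classes -/

/-- Such descriptions in terms of the order and the nodes show that the edges do not depend on the
chosen embedding; the parallel edges 4 and 5 are described only jointly. -/
theorem exists_eq_pt_iff {e : Fin 6} (he : e < 3) (w : Ladder) :
    (∃ q, w = pt e q) ↔ node (edgeSrc e) < w ∧ w < node (edgeTgt e) := by
  constructor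
  · rintro ⟨q, rfl⟩
    simp
  · rintro ⟨h1, h2⟩
    rcases w with k | ⟨f, q⟩
    · rw [node_lt_node] at h1 h2
      exact ((node_eq_of_between he h1.le h2.le).elim h1.ne' h2.ne).elim
    · obtain rfl := edge_eq_of_le he (node_lt_pt.mp h1) (pt_lt_node.mp h2)
      exact ⟨q, rfl⟩

theorem exists_eq_pt_three_iff (w : Ladder) :
    (∃ q, w = pt 3 q) ↔ node 1 < w ∧ ¬ node 2 ≤ w ∧ ¬ w ≤ node 2 := by
  have h0 : ∀ f, 1 ≤ edgeSrc f ∧ ¬ 2 ≤ edgeSrc f ∧ ¬ edgeTgt f ≤ 2 ↔ f = 3 := by decide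
  rcases w with k | ⟨f, q⟩
  · have := le_total 2 k
    simp only [reduceCtorEq, exists_false, node_le_node, false_iff]
    tauto
  · simp only [pt.injEq, exists_and_left, exists_eq', and_true, node_lt_pt, node_le_pt, pt_le_node, h0]

theorem exists_eq_pt_four_or_five_iff (w : Ladder) :
    ((∃ q, w = pt 4 q) ∨ ∃ q, w = pt 5 q) ↔ w < node 2 ∧ ¬ node 1 ≤ w ∧ ¬ w ≤ node 1 := by
  have h0 : ∀ f, edgeTgt f ≤ 2 ∧ ¬ 1 ≤ edgeSrc f ∧ ¬ edgeTgt f ≤ 1 ↔ f = 4 ∨ f = 5 := by decide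
  rcases w with k | ⟨f, q⟩
  · have := le_total 1 k
    simp only [reduceCtorEq, exists_false, node_le_node, or_false, false_iff]
    tauto
  · simp only [pt.injEq, exists_and_left, exists_eq', and_true, pt_lt_node, node_le_pt, pt_le_node, h0]

/-- The elements that `f` maps to the edge `e`. -/
def edgeSet {L : Type*} (f : L → Ladder) (e : Fin 6) : Set L := {x | ∃ q, f x = pt e q}

theorem ncard_edgeSet {L : Type*} [PartialOrder L] (f : L ↪o Ladder) (e : Fin 6) :
    (edgeSet f e).ncard = (fib (Set.range f) e).ncard := by
  have hpt : Function.Injective (pt e) := fun _ _ h => (pt.inj h).2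
  rw [← Set.ncard_image_of_injective _ f.injective, ← Set.ncard_image_of_injective _ hpt]
  congr 1
  ext w
  constructor
  · rintro ⟨x, ⟨q, hq⟩, rfl⟩
    exact ⟨q, ⟨x, hq⟩, hq.symm⟩
  · rintro ⟨q, ⟨x, hx⟩, rfl⟩
    exact ⟨x, ⟨q, hx⟩, hx⟩

theorem eq_self_of_strictMono {σ : Fin 4 → Fin 4} (h : StrictMono σ) (i : Fin 4) : σ i = i := by
  have h0 : σ 0 < σ 1 := h (by decide)
  have h1 : σ 1 < σ 2 := h (by decide)
  have h2 : σ 2 < σ 3 := h (by decide)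
  fin_cases i <;> simp only [Fin.zero_eta, Fin.mk_one, Fin.reduceFinMk] <;> omega

/-- The preimages of the nodes are the reducible elements of `L` under either embedding, and a
strictly increasing self-map of a four-element chain is the identity. -/
theorem exists_common_nodes {L : Type*} [Lattice L] (f g : L ↪o Ladder)
    (hf : IsGood (Set.range f)) (hg : IsGood (Set.range g)) :
    ∃ ν : Fin 4 → L, (∀ i, f (ν i) = node i) ∧ ∀ i, g (ν i) = node i := by
  choose ν hν using hf.node_mem
  have h := fun i => (mem_redSet_iff_of_isGood g hg (ν i)).mp
    ((mem_redSet_iff_of_isGood f hf (ν i)).mpr ⟨i, hν i⟩)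
  choose σ hσ using h
  refine ⟨ν, hν, fun i => ?_⟩
  have hmono : StrictMono σ := fun i k hik => by
    rw [← node_lt_node, ← hσ, ← hσ, g.lt_iff_lt, ← f.lt_iff_lt, hν, hν]
    exact node_lt_node.mpr hik
  rw [hσ, eq_self_of_strictMono hmono]

theorem edgeSet_eq_of_nodes {L : Type*} [PartialOrder L] (f : L ↪o Ladder) {ν : Fin 4 → L}
    (hν : ∀ i, f (ν i) = node i) {e : Fin 6} (he : e < 3) :
    edgeSet f e = {x | ν (edgeSrc e) < x ∧ x < ν (edgeTgt e)} := by
  ext x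
  change (∃ q, f x = pt e q) ↔ _
  rw [exists_eq_pt_iff he, ← hν, ← hν, f.lt_iff_lt, f.lt_iff_lt]
  rfl

theorem edgeSet_three_eq_of_nodes {L : Type*} [PartialOrder L] (f : L ↪o Ladder) {ν : Fin 4 → L}
    (hν : ∀ i, f (ν i) = node i) :
    edgeSet f 3 = {x | ν 1 < x ∧ ¬ ν 2 ≤ x ∧ ¬ x ≤ ν 2} := by
  ext x
  change (∃ q, f x = pt 3 q) ↔ _
  rw [exists_eq_pt_three_iff, ← hν, ← hν, f.lt_iff_lt, f.le_iff_le, f.le_iff_le]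
  rfl

theorem edgeSet_four_union_five_eq_of_nodes {L : Type*} [PartialOrder L] (f : L ↪o Ladder)
    {ν : Fin 4 → L} (hν : ∀ i, f (ν i) = node i) :
    edgeSet f 4 ∪ edgeSet f 5 = {x | x < ν 2 ∧ ¬ ν 1 ≤ x ∧ ¬ x ≤ ν 1} := by
  ext x
  change ((∃ q, f x = pt 4 q) ∨ ∃ q, f x = pt 5 q) ↔ _
  rw [exists_eq_pt_four_or_five_iff, ← hν, ← hν, f.lt_iff_lt, f.le_iff_le, f.le_iff_le]
  rfl

/-- Incomparable pairs in the union of the parallel edges take one element from each, in either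
order. This makes the product of the two sizes an invariant. -/
theorem ncard_incomparable {L : Type*} [PartialOrder L] [Finite L] (f : L ↪o Ladder) :
    {p : L × L | p.1 ∈ edgeSet f 4 ∪ edgeSet f 5 ∧ p.2 ∈ edgeSet f 4 ∪ edgeSet f 5 ∧
      ¬ p.1 ≤ p.2 ∧ ¬ p.2 ≤ p.1}.ncard = 2 * ((edgeSet f 4).ncard * (edgeSet f 5).ncard) := by
  have h45 : ∀ p q, ¬ pt 4 p ≤ pt 5 q := fun p q => by
    rw [pt_le_pt_of_ne (by decide)]
    decide
  have h54 : ∀ p q, ¬ pt 5 p ≤ pt 4 q := fun p q => by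
    rw [pt_le_pt_of_ne (by decide)]
    decide
  have hset : {p : L × L | p.1 ∈ edgeSet f 4 ∪ edgeSet f 5 ∧ p.2 ∈ edgeSet f 4 ∪ edgeSet f 5 ∧
      ¬ p.1 ≤ p.2 ∧ ¬ p.2 ≤ p.1} =
      (edgeSet f 4 ×ˢ edgeSet f 5) ∪ (edgeSet f 5 ×ˢ edgeSet f 4) := by
    ext ⟨x, y⟩
    simp only [Set.mem_ofPred_eq, Set.mem_union, Set.mem_prod, ← f.le_iff_le]
    constructor
    · rintro ⟨⟨p, hp⟩ | ⟨p, hp⟩, ⟨q, hq⟩ | ⟨q, hq⟩, h1, h2⟩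
      · rw [hp, hq, pt_le_pt_self] at h1 h2
        exact absurd (le_total p q) (not_or.mpr ⟨h1, h2⟩)
      · exact Or.inl ⟨⟨p, hp⟩, ⟨q, hq⟩⟩
      · exact Or.inr ⟨⟨p, hp⟩, ⟨q, hq⟩⟩
      · rw [hp, hq, pt_le_pt_self] at h1 h2
        exact absurd (le_total p q) (not_or.mpr ⟨h1, h2⟩)
    · rintro (⟨⟨p, hp⟩, ⟨q, hq⟩⟩ | ⟨⟨p, hp⟩, ⟨q, hq⟩⟩)
      · exact ⟨Or.inl ⟨p, hp⟩, Or.inr ⟨q, hq⟩, by rw [hp, hq]; exact h45 _ _,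
          by rw [hp, hq]; exact h54 _ _⟩
      · exact ⟨Or.inr ⟨p, hp⟩, Or.inl ⟨q, hq⟩, by rw [hp, hq]; exact h54 _ _,
          by rw [hp, hq]; exact h45 _ _⟩
  rw [hset, Set.ncard_union_eq, Set.ncard_prod, Set.ncard_prod]
  · ring
  · rw [Set.disjoint_left]
    rintro ⟨x, y⟩ ⟨⟨p, hp⟩, -⟩ ⟨⟨q, hq⟩, -⟩
    exact absurd (pt.inj (hp.symm.trans hq)).1 (by decide)

theorem card_eq_of_embedding {L : Type*} [PartialOrder L] (f : L ↪o Ladder)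
    (hf : IsGood (Set.range f)) : Nat.card L = 4 + ∑ e, (fib (Set.range f) e).ncard := by
  rw [← card_eq_of_isGood hf]
  exact Nat.card_congr f.orderIso.toEquiv

theorem eq_of_add_eq_of_mul_eq {u v u' v' : ℕ} (huv : u ≤ v) (huv' : u' ≤ v')
    (hadd : u + v = u' + v') (hmul : u * v = u' * v') : u = u' ∧ v = v' := by
  suffices h : u = u' by omega
  zify at hadd hmul huv huv' ⊢
  have h : ((u' : ℤ) - u) * (u' - v) = 0 := by linear_combination hmul - u' * hadd
  rcases mul_eq_zero.mp h with h | h <;> omega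

/-- Sizes on edges 0 to 3 are read off from the nodes. For edges 4 and 5 the total cardinality gives
the sum and the incomparable pairs give the product, so the ordered pair of sizes is determined. -/
theorem ncard_fib_eq {L : Type*} [Lattice L] (f g : L ↪o Ladder) (hf : IsGood (Set.range f))
    (hg : IsGood (Set.range g))
    (hf' : (fib (Set.range f) 4).ncard ≤ (fib (Set.range f) 5).ncard)
    (hg' : (fib (Set.range g) 4).ncard ≤ (fib (Set.range g) 5).ncard) (e : Fin 6) :
    (fib (Set.range f) e).ncard = (fib (Set.range g) e).ncard := by
  have : Finite L := (Set.finite_range_iff f.injective).mp hf.finite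
  obtain ⟨ν, hν, hν'⟩ := exists_common_nodes f g hf hg
  have hlow : ∀ e < 3, (fib (Set.range f) e).ncard = (fib (Set.range g) e).ncard := fun e he => by
    rw [← ncard_edgeSet, ← ncard_edgeSet, edgeSet_eq_of_nodes f hν he, edgeSet_eq_of_nodes g hν' he]
  have h3 : (fib (Set.range f) 3).ncard = (fib (Set.range g) 3).ncard := by
    rw [← ncard_edgeSet, ← ncard_edgeSet, edgeSet_three_eq_of_nodes f hν,
      edgeSet_three_eq_of_nodes g hν']
  have hmul := ncard_incomparable f
  rw [edgeSet_four_union_five_eq_of_nodes f hν, ← edgeSet_four_union_five_eq_of_nodes g hν',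
    ncard_incomparable g] at hmul
  simp only [ncard_edgeSet] at hmul
  have hadd := (card_eq_of_embedding f hf).symm.trans (card_eq_of_embedding g hg)
  simp only [Fin.sum_univ_six, hlow 0 (by decide), hlow 1 (by decide), hlow 2 (by decide),
    h3] at hadd
  have h45 := eq_of_add_eq_of_mul_eq hf' hg' (by omega) (by omega)
  fin_cases e
  exacts [hlow 0 (by decide), hlow 1 (by decide), hlow 2 (by decide), h3, h45.1, h45.2]

theorem ncard_fib_eq_of_orderIso {L M : Type*} [Lattice L] [Lattice M] (ε : L ≃o M)
    (f : L ↪o Ladder) (g : M ↪o Ladder) (hf : IsGood (Set.range f)) (hg : IsGood (Set.range g))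
    (hf' : (fib (Set.range f) 4).ncard ≤ (fib (Set.range f) 5).ncard)
    (hg' : (fib (Set.range g) 4).ncard ≤ (fib (Set.range g) 5).ncard) (e : Fin 6) :
    (fib (Set.range f) e).ncard = (fib (Set.range g) e).ncard := by
  have h : Set.range (ε.toOrderEmbedding.trans g) = Set.range g := ε.surjective.range_comp g
  rw [← h] at hg hg' ⊢
  exact ncard_fib_eq f _ hf hg hf' hg' e

/-- Interchange of the two edges from the node `0` to the node `2`. -/
def swapEdges : Ladder ↪o Ladder :=
  OrderEmbedding.ofMapLEIff
    (fun x => match x with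
      | .node i => .node i
      | .pt e q => .pt (Equiv.swap 4 5 e) q)
    (by
      have h1 : ∀ e, edgeSrc (Equiv.swap 4 5 e) = edgeSrc e := by decide
      have h2 : ∀ e, edgeTgt (Equiv.swap 4 5 e) = edgeTgt e := by decide
      rintro (i | ⟨e, p⟩) (k | ⟨f, q⟩) <;> simp [pt_le_pt, h1, h2])

theorem fib_range_trans_swapEdges {L : Type*} [PartialOrder L] (f : L ↪o Ladder) (e : Fin 6) :
    fib (Set.range (f.trans swapEdges)) e = fib (Set.range f) (Equiv.swap 4 5 e) := by
  ext q
  constructor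
  · rintro ⟨x, hx⟩
    change swapEdges (f x) = _ at hx
    refine ⟨x, ?_⟩
    rcases h : f x with i | ⟨f, r⟩ <;> rw [h] at hx
    · cases hx
    · obtain ⟨h1, h2⟩ := pt.inj hx
      rw [← h1, h2, Equiv.swap_apply_self]
  · rintro ⟨x, hx⟩
    refine ⟨x, ?_⟩
    change swapEdges (f x) = _
    rw [hx]
    exact congrArg (pt · q) (Equiv.swap_apply_self _ _ _)

theorem isGood_trans_swapEdges {L : Type*} [PartialOrder L] (f : L ↪o Ladder)
    (hf : IsGood (Set.range f)) : IsGood (Set.range (f.trans swapEdges)) := by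
  have : Finite L := (Set.finite_range_iff f.injective).mp hf.finite
  refine ⟨Set.finite_range _, fun i => ?_, fun e he => ?_⟩
  · obtain ⟨x, hx⟩ := hf.node_mem i
    exact ⟨x, congrArg swapEdges hx⟩
  · change (fib (Set.range (f.trans swapEdges)) e).Nonempty
    rw [fib_range_trans_swapEdges]
    exact hf.exists_pt _ (by revert e; decide)

theorem exists_ordered_embedding {L : Type*} [PartialOrder L] (f : L ↪o Ladder)
    (hf : IsGood (Set.range f)) : ∃ g : L ↪o Ladder, IsGood (Set.range g) ∧
      (fib (Set.range g) 4).ncard ≤ (fib (Set.range g) 5).ncard := by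
  rcases le_total (fib (Set.range f) 4).ncard (fib (Set.range f) 5).ncard with h | h
  · exact ⟨f, hf, h⟩
  · refine ⟨f.trans swapEdges, isGood_trans_swapEdges f hf, ?_⟩
    rw [fib_range_trans_swapEdges, fib_range_trans_swapEdges]
    simpa using h

/-- The set with the points `0, …, n e - 1` on each edge `e`. -/
def stdSet (n : Fin 6 → ℕ) : Set Ladder :=
  Set.range (Sum.elim node fun p : Σ e, Fin (n e) => pt p.1 (p.2 : ℕ))

theorem fib_stdSet (n : Fin 6 → ℕ) (e : Fin 6) :
    fib (stdSet n) e = Set.range fun k : Fin (n e) => ((k : ℕ) : ℚ) := by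
  ext q
  constructor
  · rintro ⟨i | ⟨e, k⟩, h⟩
    · cases h
    · obtain ⟨rfl, rfl⟩ := pt.inj h
      exact ⟨k, rfl⟩
  · rintro ⟨k, rfl⟩
    exact ⟨.inr ⟨e, k⟩, rfl⟩

theorem ncard_fib_stdSet (n : Fin 6 → ℕ) (e : Fin 6) : (fib (stdSet n) e).ncard = n e := by
  rw [fib_stdSet, ← Set.image_univ, Set.ncard_image_of_injective, Set.ncard_univ, Nat.card_fin]
  exact fun k l h => Fin.ext (Nat.cast_injective h)

theorem isGood_stdSet {n : Fin 6 → ℕ} (hn : ∀ e, 3 ≤ e → 1 ≤ n e) : IsGood (stdSet n) :=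
  ⟨Set.finite_range _, fun i => ⟨.inl i, rfl⟩, fun e he => ⟨0, .inr ⟨e, ⟨0, hn e he⟩⟩, by simp⟩⟩

theorem exists_lattice_of_isGood {A : Set Ladder} (hA : IsGood A) {j : ℕ} (hj : Nat.card A = j) :
    ∃ I : Lattice (Fin j), ∃ f : @OrderEmbedding (Fin j) Ladder I.toLE _, Set.range f = A := by
  have := hA.finite.to_subtype
  let e : Fin j ≃ A := ((Finite.equivFin A).trans (finCongr hj)).symm
  let g : Fin j → Ladder := fun x => e x
  have hg : Function.Injective g := Subtype.val_injective.comp e.injective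
  let I : Lattice (Fin j) :=
    @Function.Injective.lattice (Fin j) Ladder
      ⟨fun x y => e.symm ⟨g x ⊔ g y, hA.sup_mem (e x).2 (e y).2⟩⟩
      ⟨fun x y => e.symm ⟨g x ⊓ g y, hA.inf_mem (e x).2 (e y).2⟩⟩
      ⟨fun x y => g x ≤ g y⟩ ⟨fun x y => g x < g y⟩ _ g hg Iff.rfl Iff.rfl
      (fun x y => congrArg Subtype.val (e.apply_symm_apply _))
      (fun x y => congrArg Subtype.val (e.apply_symm_apply _))
  refine ⟨I, @OrderEmbedding.ofMapLEIff (Fin j) Ladder I.toPartialOrder _ g fun x y => Iff.rfl, ?_⟩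
  change Set.range (Subtype.val ∘ e) = A
  rw [e.surjective.range_comp, Subtype.range_coe]

/-- The numbers of points on the edges, for blocks with `j` elements. -/
def edgeCounts (j : ℕ) : Set (Fin 6 → ℕ) :=
  {n | (∀ e, 3 ≤ e → 1 ≤ n e) ∧ n 4 ≤ n 5 ∧ 4 + ∑ e, n e = j}

/-- Each tuple is sent to the class of its standard good set. This is injective by invariance of the
ordered counts, and onto because a good embedding can be ordered by swapping the parallel edges. -/
theorem numBlocksWith_basicBlockOne (j : ℕ) :
    numBlocksWith BasicBlockOne j 4 3 = (edgeCounts j).ncard := by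
  have key : ∀ n : edgeCounts j, ∃ I : Lattice (Fin j),
      ∃ f : @OrderEmbedding (Fin j) Ladder I.toLE _, Set.range f = stdSet n := fun n => by
    have hg := isGood_stdSet n.2.1
    refine exists_lattice_of_isGood hg ?_
    rw [card_eq_of_isGood hg]
    simp only [ncard_fib_stdSet]
    exact n.2.2.2
  choose I f hf using key
  let Φ : edgeCounts j → Quotient (latticeIsoSetoid j) := fun n => Quotient.mk _ (I n)
  have hgood : ∀ n, IsGood (Set.range (f n)) := fun n => (hf n).symm ▸ isGood_stdSet n.2.1
  have hcount : ∀ n e, (fib (Set.range (f n)) e).ncard = n.1 e := fun n e => by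
    rw [hf, ncard_fib_stdSet]
  have hΦ : Function.Injective Φ := by
    intro n m h
    obtain ⟨e⟩ := Quotient.exact h
    refine Subtype.ext (funext fun i => ?_)
    have := @ncard_fib_eq_of_orderIso _ _ (I n) (I m) e (f n) (f m) (hgood n) (hgood m)
      (by rw [hcount, hcount]; exact n.2.2.1) (by rw [hcount, hcount]; exact m.2.2.1) i
    rwa [hcount, hcount] at this
  have himage : Quotient.mk (latticeIsoSetoid j) ''
      {I : Lattice (Fin j) | @IsBlockWith BasicBlockOne _ 4 3 (Fin j) I} = Set.range Φ := by
    ext q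
    constructor
    · rintro ⟨J, hJ, rfl⟩
      obtain ⟨g₀, hg₀⟩ := (@isBlockWith_iff (Fin j) J _).mp hJ
      obtain ⟨g, hg, hg'⟩ := @exists_ordered_embedding (Fin j) J.toPartialOrder g₀ hg₀
      let n : Fin 6 → ℕ := fun e => (fib (Set.range g) e).ncard
      have hn : n ∈ edgeCounts j := by
        refine ⟨fun e he => hg.ncard_fib_pos he, hg', ?_⟩
        have := @card_eq_of_embedding (Fin j) J.toPartialOrder g hg
        rw [Nat.card_fin] at this
        exact this.symm
      obtain ⟨φ⟩ := nonempty_orderIso_of_ncard_fib_eq (hgood ⟨n, hn⟩) hg (hcount ⟨n, hn⟩)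
      refine ⟨⟨n, hn⟩, Quotient.sound ?_⟩
      have h1 := @OrderEmbedding.orderIso _ _ (I ⟨n, hn⟩).toLE _ (f ⟨n, hn⟩)
      have h2 := @OrderEmbedding.orderIso _ _ J.toLE _ g
      exact ⟨@OrderIso.trans _ _ _ (_) (_) (_) (@OrderIso.trans _ _ _ (_) (_) (_) h1 φ)
        (@OrderIso.symm _ _ (_) (_) h2)⟩
    · rintro ⟨n, rfl⟩
      exact ⟨I n, (@isBlockWith_iff (Fin j) (I n) _).mpr ⟨f n, hgood n⟩, rfl⟩
  rw [numBlocksWith, himage, ← Set.image_univ, Set.ncard_image_of_injective _ hΦ, Set.ncard_univ]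
  rfl

end Ladder

/-! ### Evaluation of the count -/

/-- A partition into two parts is determined by its smaller part, which ranges over `1, …, l / 2`.
-/
theorem numPartitions_two (l : ℕ) : numPartitions l 2 = l / 2 := by
  have hl : l / 2 = (Finset.Icc 1 (l / 2)).card := by simp
  rw [hl, numPartitions]
  symm
  refine Finset.card_bij (fun u hu => ⟨{u, l - u}, ?_, ?_⟩) ?_ ?_ ?_
  · intro i hi
    rw [Finset.mem_Icc] at hu
    simp only [Multiset.insert_eq_cons, Multiset.mem_cons, Multiset.mem_singleton] at hi
    omega
  · rw [Finset.mem_Icc] at hu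
    simp only [Multiset.insert_eq_cons, Multiset.sum_cons, Multiset.sum_singleton]
    omega
  · intro u hu
    simp
  · intro u hu v hv h
    rw [Finset.mem_Icc] at hu hv
    have h1 : u ∈ ({v, l - v} : Multiset ℕ) := by
      have h2 : ({u, l - u} : Multiset ℕ) = {v, l - v} := congrArg Nat.Partition.parts h
      simp [← h2]
    simp only [Multiset.insert_eq_cons, Multiset.mem_cons, Multiset.mem_singleton] at h1
    omega
  · intro p hp
    rw [Finset.mem_filter] at hp
    obtain ⟨a, b, hab⟩ := Multiset.card_eq_two.mp hp.2
    have ha : 0 < a := p.parts_pos (by simp [hab])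
    have hb : 0 < b := p.parts_pos (by simp [hab])
    have hs : a + b = l := by
      have := p.parts_sum
      rw [hab] at this
      simpa using this
    rcases le_total a b with h | h
    · refine ⟨a, by rw [Finset.mem_Icc]; omega, Nat.Partition.ext ?_⟩
      change ({a, l - a} : Multiset ℕ) = _
      rw [hab, show l - a = b by omega]
    · refine ⟨b, by rw [Finset.mem_Icc]; omega, Nat.Partition.ext ?_⟩
      change ({b, l - b} : Multiset ℕ) = _
      rw [hab, show l - b = a by omega]
      exact Multiset.pair_comm _ _

namespace Ladder

theorem ncard_edgeCounts (j : ℕ) : (edgeCounts j).ncard =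
    ∑ s ∈ Finset.Icc 1 (j - 6), ∑ r ∈ Finset.Icc 1 (j - s - 5),
      ∑ l ∈ Finset.Icc 2 (j - s - r - 3), (j - s - r - l - 2) * numPartitions l 2 := by
  let F : Finset (Σ _ : ℕ, Σ _ : ℕ, Σ _ : ℕ, ℕ × ℕ) :=
    (Finset.Icc 1 (j - 6)).sigma fun s => (Finset.Icc 1 (j - s - 5)).sigma fun r =>
      (Finset.Icc 2 (j - s - r - 3)).sigma fun l =>
        Finset.range (j - s - r - l - 2) ×ˢ Finset.Icc 1 (l / 2)
  have hF : F.card = ∑ s ∈ Finset.Icc 1 (j - 6), ∑ r ∈ Finset.Icc 1 (j - s - 5),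
      ∑ l ∈ Finset.Icc 2 (j - s - r - 3), (j - s - r - l - 2) * numPartitions l 2 := by
    simp [F, Finset.card_sigma, numPartitions_two]
  have hmem : ∀ s r l q u, (⟨s, r, l, q, u⟩ : Σ _ : ℕ, Σ _ : ℕ, Σ _ : ℕ, ℕ × ℕ) ∈ F ↔
      (1 ≤ s ∧ s ≤ j - 6) ∧ (1 ≤ r ∧ r ≤ j - s - 5) ∧ (2 ≤ l ∧ l ≤ j - s - r - 3) ∧
        q < j - s - r - l - 2 ∧ 1 ≤ u ∧ u ≤ l / 2 := by
    simp [F, Finset.mem_sigma]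
  -- `s` is the size of edge 3, `r` exceeds that of edge 0 by one, and `l` is the total on the
  -- parallel edges with smaller share `u`. Edges 1 and 2 share the remaining `j - s - r - l - 3`
  -- elements, `q` of them on edge 1, which gives `j - s - r - l - 2` choices.
  let g : (Σ _ : ℕ, Σ _ : ℕ, Σ _ : ℕ, ℕ × ℕ) → Fin 6 → ℕ := fun ⟨s, r, l, q, u⟩ =>
    ![r - 1, q, j - s - r - l - 3 - q, s, u, l - u]
  rw [← hF, ← Set.ncard_coe_finset, ← Set.InjOn.ncard_image (f := g)]
  · congr 1
    ext n
    constructor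
    · rintro ⟨h1, h2, h3⟩
      have h13 := h1 3 (by decide)
      have h14 := h1 4 (by decide)
      have h15 := h1 5 (by decide)
      rw [Fin.sum_univ_six] at h3
      refine ⟨⟨n 3, n 0 + 1, n 4 + n 5, n 1, n 4⟩, ?_, ?_⟩
      · rw [Finset.mem_coe, hmem]
        omega
      · ext e
        fin_cases e <;> simp [g] <;> omega
    · rintro ⟨⟨s, r, l, q, u⟩, h, rfl⟩
      rw [Finset.mem_coe, hmem] at h
      refine ⟨fun e he => ?_, ?_, ?_⟩
      · fin_cases e <;> simp [g] at he ⊢ <;> omega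
      · simp [g]; omega
      · simp [Fin.sum_univ_six, g]; omega
  · rintro ⟨s, r, l, q, u⟩ h ⟨s', r', l', q', u'⟩ h' hg
    rw [Finset.mem_coe, hmem] at h h'
    have h0 := congrFun hg 0
    have h1 := congrFun hg 1
    have h3 := congrFun hg 3
    have h4 := congrFun hg 4
    have h5 := congrFun hg 5
    simp [g] at h0 h1 h3 h4 h5
    obtain rfl : s = s' := by omega
    obtain rfl : r = r' := by omega
    obtain rfl : l = l' := by omega
    obtain rfl : q = q' := by omega
    obtain rfl : u = u' := by omega
    rfl

end Ladder

theorem mainTheorem7 (j : ℕ) (hj : 7 ≤ j) :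
    (numBlocksWith BasicBlockOne j 4 3 =
      ∑ s ∈ Finset.Icc 1 (j - 6), ∑ r ∈ Finset.Icc 1 (j - s - 5),
        ∑ l ∈ Finset.Icc 2 (j - s - r - 3), (j - s - r - l - 2) * numPartitions l 2) ∧
    (numBlocksWith BasicBlockTwo j 4 3 =
      ∑ s ∈ Finset.Icc 1 (j - 6), ∑ r ∈ Finset.Icc 1 (j - s - 5),
        ∑ l ∈ Finset.Icc 2 (j - s - r - 3), (j - s - r - l - 2) * numPartitions l 2) ∧
    (∀ (L : Type) [Lattice L], Nat.card L = j → IsBlockWith BasicBlockOne 4 3 L →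
      HasAdjunctRepresentation L) := by
  have h := (Ladder.numBlocksWith_basicBlockOne j).trans (Ladder.ncard_edgeCounts j)
  refine ⟨h, (numBlocksWith_dual BasicBlockOne j 4 3).trans h, fun L _ hL hB => ?_⟩
  -- An infinite type has `Nat.card` equal to 0, which `7 ≤ j` rules out.
  have : Finite L := Nat.finite_of_card_ne_zero (by omega)
  obtain ⟨f, hf⟩ := Ladder.isBlockWith_iff.mp hB
  exact Ladder.hasAdjunctRepresentation f hf
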